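/- **Definitions.** For a finite poset $S=\{s_1,\dots,s_n\}$ put $f_S(x_1,\dots,x_n)=\sum_{s_i\le s_j}x_ix_j$ (the sum over all pairs $(i,j)$ with $s_i\le s_j$, including $i=j$). The Hasse graph of $S$ has vertex set $S$, with an edge between $s$ and $s'$ whenever one of them covers the other. For a differentiable $f:\mathbb R^n\to\mathbb R$ let $C(f)$ be the set of all $h\in\mathbb R^n\setminus\{0\}$ with $\sum_i h_i=0$ such that either $\frac{\partial f}{\partial x_i}(h)\le 0$ for all $i$ or $\frac{\partial f}{\partial x_i}(h)\ge 0$ for all $i$; $f$ is *antimonotonous* if $C(f)=\varnothing$, and $C(S):=C(f_S)$. Let $P_n=\{x\in\mathbb R^n : 0<x_i\le 1,\ \sum_i x_i=1\}$ and let $\overline P_n=\{x : 0\le x_i\le 1,\ \sum_i x_i=1\}$ be its closure. $S$ is *$P$-faithful* if there is $u\in P_n$ with $f_S(u)>0$, $f_S(u)\le f_S(w)$ for all $w\in\overline P_n$, and $f_S(u)<f_S(w)$ for all $w\in\overline P_n\setminus P_n$. A *wattle* $\langle n_1,\dots,n_t\rangle$ $(t>1)$ is a poset that is the disjoint union of chains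 $Z_1,\dots,Z_t$ with $|Z_i|=n_i\ge 2$, in which the minimal element of $Z_i$ is less than the maximal element of $Z_{i+1}$ $(1\le i<t)$ and there are no other comparisons between elements of different $Z_i$. For a noninteger rational $r>1$ whose fractional part $r-\lfloor r\rfloor$ equals $q/t$ in lowest terms, the *uniform wattle* $\zeta(r)$ is the wattle $\langle n_1,\dots,n_t\rangle$ with $n_1=n_t=\lfloor r\rfloor+1$ and $n_i=\lfloor ri\rfloor-\lfloor r(i-1)\rfloor+1$ for $1<i<t$. An *$r$-set* is a poset that is a chain or is isomorphic to $\zeta(r)$ for some noninteger rational $r>1$. **Theorem.** Let $S$ be a finite nonempty poset with connected Hasse graph. 1. If $f_S$ is positive semidefinite (that is, $f_S(x)\ge 0$ for all $x\in\mathbb R^n$), then $C(S)=\varnothing$ (i.e. $f_S$ is antimonotonous) if and only if $S$ is an $r$-set. 2. $S$ is $P$-faithful if and only if $S$ is an $r$-set. In particular, if $f_S$ is positive semidefinite, then $S$ is $P$-faithful if and only if $f_S$ is antimonotonous. -/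

import Mathlib

namespace AntimonotonousPosets

section Functions

variable {ι : Type*} [Fintype ι]

/-- The partial derivative `∂f/∂x_i` at the point `x`. -/
noncomputable def partialDeriv (f : (ι → ℝ) → ℝ) (i : ι) (x : ι → ℝ) : ℝ :=
  open Classical in fderiv ℝ f x (Pi.single i 1)

/-- `C⁻(f)`: the nonzero vectors with coordinate sum `0` at which all partial derivatives of `f`
are nonpositive. -/
def Cminus (f : (ι → ℝ) → ℝ) : Set (ι → ℝ) :=
  {h | h ≠ 0 ∧ ∑ i, h i = 0 ∧ ∀ i, partialDeriv f i h ≤ 0}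

/-- `C⁺(f)`: the nonzero vectors with coordinate sum `0` at which all partial derivatives of `f`
are nonnegative. -/
def Cplus (f : (ι → ℝ) → ℝ) : Set (ι → ℝ) :=
  {h | h ≠ 0 ∧ ∑ i, h i = 0 ∧ ∀ i, 0 ≤ partialDeriv f i h}

/-- `C(f) = C⁺(f) ∪ C⁻(f)`. -/
def C (f : (ι → ℝ) → ℝ) : Set (ι → ℝ) := Cplus f ∪ Cminus f

/-- A (differentiable) function `f` is antimonotonous if `C(f) = ∅`. -/
def IsAntimonotonous (f : (ι → ℝ) → ℝ) : Prop := C f = ∅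

variable (ι) in
/-- `P_n = {x | 0 < x_i ≤ 1, ∑ x_i = 1}`. -/
def P : Set (ι → ℝ) := {x | (∀ i, 0 < x i ∧ x i ≤ 1) ∧ ∑ i, x i = 1}

variable (ι) in
/-- The closure of `P_n`: `{x | 0 ≤ x_i ≤ 1, ∑ x_i = 1}`. -/
def Pbar : Set (ι → ℝ) := {x | (∀ i, 0 ≤ x i ∧ x i ≤ 1) ∧ ∑ i, x i = 1}

/-- `u` is a `P`-faithful vector for `f`: it lies in `P_n`, `f u > 0`, it minimizes `f` on the
closure of `P_n`, and no point of the closure outside `P_n` attains that minimum. -/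
def IsPFaithfulVector (f : (ι → ℝ) → ℝ) (u : ι → ℝ) : Prop :=
  u ∈ P ι ∧ 0 < f u ∧ ∀ w ∈ Pbar ι, f u ≤ f w ∧ (w ∉ P ι → f u < f w)

end Functions

section Posets

variable (S : Type*) [PartialOrder S]

/-- The quadratic form `f_S(x) = ∑_{s ≤ t} x_s x_t`, the sum running over all pairs `(s, t)` with
`s ≤ t`, including `s = t`. -/
noncomputable def posetForm [Fintype S] (x : S → ℝ) : ℝ :=
  open Classical in ∑ s : S, ∑ t : S, if s ≤ t then x s * x t else 0

/-- A finite poset is `P`-faithful if its form has a `P`-faithful vector. -/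
def IsPFaithful [Fintype S] : Prop := ∃ u, IsPFaithfulVector (posetForm S) u

variable {S} in
/-- `S` is a wattle with chains `Z 0, …, Z (t - 1)`: `S` is the disjoint union of `t > 1` chains of
at least two elements each, the least element of each chain is less than the greatest element of the
next chain, and there are no other comparisons between elements of different chains. -/
structure IsWattle {t : ℕ} (Z : Fin t → Finset S) : Prop where
  one_lt : 1 < t
  two_le_card : ∀ i, 2 ≤ (Z i).card
  disjoint : ∀ i j, i ≠ j → Disjoint (Z i) (Z j)
  cover : ∀ s, ∃ i, s ∈ Z i
  isChain : ∀ i, IsChain (· ≤ ·) (Z i : Set S)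
  lt_iff : ∀ i j, i ≠ j → ∀ a ∈ Z i, ∀ b ∈ Z j,
    (a < b ↔ (i : ℕ) + 1 = j ∧ IsLeast (Z i : Set S) a ∧ IsGreatest (Z j : Set S) b)

/-- The order `n_i` (`1 ≤ i ≤ t`) of the `i`-th chain of the uniform wattle `ζ(r)`, which has `t`
chains: `n_1 = n_t = [r] + 1` and `n_i = [r i] - [r (i - 1)] + 1` for `1 < i < t`. -/
def zetaOrder (r : ℚ) (t i : ℕ) : ℤ :=
  if i = 1 ∨ i = t then ⌊r⌋ + 1 else ⌊r * i⌋ - ⌊r * ((i : ℚ) - 1)⌋ + 1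

/-- For a noninteger rational `r > 1`: `S` is (isomorphic to) the uniform wattle `ζ(r)`. The number
of chains is the denominator of the fractional part of `r`, and the chain `Z k`, numbered from `0`,
is the chain number `k + 1` in the customary numbering from `1`. -/
def IsUniformWattle (r : ℚ) : Prop :=
  1 < r ∧ (∀ m : ℤ, r ≠ m) ∧
    ∃ Z : Fin (Int.fract r).den → Finset S, IsWattle Z ∧
      ∀ k, ((Z k).card : ℤ) = zetaOrder r (Int.fract r).den (k + 1)

/-- `S` is an `r`-set: a chain, or the uniform wattle `ζ(r)` for some noninteger rational `r > 1`. -/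
def IsRSet : Prop := IsChain (· ≤ ·) (Set.univ : Set S) ∨ ∃ r : ℚ, IsUniformWattle S r

end Posets

end AntimonotonousPosets

/-! Let A be the symmetric matrix with entry 2 on the diagonal, 1 at comparable pairs and 0
elsewhere, so that f_S(x) = (x · A x) / 2. Both properties reduce to one condition,
`HasPositiveWeight`: A is positive definite and the solution u of A u = 1 is positive. The link is
the identity Σ h_i = u · A h: it rules out sum-zero h with A h ≥ 0, and it makes u, scaled to total
1, the interior minimum on the simplex. What remains is `hasPositiveWeight_iff_isRSet`.

The main obstacle is excluded by lattices. An induced claw or diamond in the comparability graph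
spans the root lattice D_4, of determinant 4 and dual minimum 1. Enlarging it to S one comparable
element at a time never increases the determinant (`DualNormGeOne.border`), so det A ≤ 4. But by
Cramer's rule the numbers det A · u_s are positive integers, and the row of an element with three
neighbours then gives det A > 4 (`four_lt_det_of_three_neighbours`).

Without claws and diamonds, the elements comparable to a given one form one clique, or two cliques
that meet only in that element and whose weights add up to 1. By connectedness only two clique
weights occur, β > 1/2 and 1 - β. The cliques of weight β partition S into chains; those of weight 1
- β are single pairs that join the least element of one chain to the greatest of another. Positive
definiteness forbids that the chains close up into a cycle, so S is a chain or a wattle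
(`IsSplit.exists_isWattle`).

For a wattle the form is an explicit sum of squares, so only the positivity of u is at stake. The
equations say that the partial sums of n_j - 1 equal r i - X_i with 0 < X_i < 1 for 0 < i < t and
X_t = 1. Hence these sums are ⌊r i⌋ for i < t and r has denominator t: this is the uniform wattle
ζ(r). -/

namespace AntimonotonousPosets

open Matrix

/-! ### Antimonotonicity and P-faithfulness of a quadratic form in terms of positive weights -/

section QuadraticForms

variable {ι : Type*} [Fintype ι]

theorem dotProduct_mulVec_symm {A : Matrix ι ι ℝ} (hA : A.IsSymm) (x y : ι → ℝ) :
    x ⬝ᵥ A *ᵥ y = y ⬝ᵥ A *ᵥ x := by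
  rw [dotProduct_mulVec, ← mulVec_transpose, hA.eq, dotProduct_comm]

/-- The quadratic form `x ↦ (x ⬝ A x) / 2`. -/
noncomputable def halfForm (A : Matrix ι ι ℝ) (x : ι → ℝ) : ℝ := (x ⬝ᵥ A *ᵥ x) / 2

theorem halfForm_add_smul {A : Matrix ι ι ℝ} (hA : A.IsSymm) (x h : ι → ℝ) (τ : ℝ) :
    halfForm A (x + τ • h) = halfForm A x + τ * (h ⬝ᵥ A *ᵥ x) + τ ^ 2 * halfForm A h := by
  have := dotProduct_mulVec_symm hA x h
  simp only [halfForm, mulVec_add, mulVec_smul, dotProduct_add, add_dotProduct, smul_dotProduct,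
    dotProduct_smul, smul_eq_mul, this]
  ring

theorem hasFDerivAt_halfForm [DecidableEq ι] {A : Matrix ι ι ℝ} (hA : A.IsSymm) (x : ι → ℝ) :
    HasFDerivAt (halfForm A)
      (∑ i, (A *ᵥ x) i • (ContinuousLinearMap.proj i : (ι → ℝ) →L[ℝ] ℝ)) x := by
  have h1 : ∀ i, HasFDerivAt (fun y : ι → ℝ => y i)
      (ContinuousLinearMap.proj i : (ι → ℝ) →L[ℝ] ℝ) x := fun i => hasFDerivAt_apply i x
  have h2 : HasFDerivAt (fun y : ι → ℝ => (∑ i, y i * ∑ j, A i j * y j) * (1 / 2))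
      ((1 / 2 : ℝ) • ∑ i, (x i • ∑ j, A i j • (ContinuousLinearMap.proj j : (ι → ℝ) →L[ℝ] ℝ)
        + (∑ j, A i j * x j) • (ContinuousLinearMap.proj i : (ι → ℝ) →L[ℝ] ℝ))) x :=
    HasFDerivAt.mul_const (HasFDerivAt.fun_sum fun i _ => (h1 i).mul
      (HasFDerivAt.fun_sum fun j _ => (h1 j).const_mul (A i j))) _
  convert h2 using 1
  · funext y
    simp only [halfForm, dotProduct, mulVec]
    ring
  · ext y
    have key := dotProduct_mulVec_symm hA x y
    simp only [dotProduct, mulVec] at key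
    simp only [FunLike.coe_sum, Finset.sum_apply, FunLike.coe_smul,
      Pi.smul_apply, ContinuousLinearMap.proj_apply, smul_eq_mul, _root_.add_apply,
      Finset.sum_add_distrib, mulVec, dotProduct, key]
    have hswap : ∑ i, y i * ∑ j, A i j * x j = ∑ i, (∑ j, A i j * x j) * y i :=
      Finset.sum_congr rfl fun i _ => mul_comm _ _
    rw [hswap]
    ring

theorem partialDeriv_halfForm {A : Matrix ι ι ℝ} (hA : A.IsSymm) (i : ι) (x : ι → ℝ) :
    partialDeriv (halfForm A) i x = (A *ᵥ x) i := by
  classical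
  unfold partialDeriv
  rw [(hasFDerivAt_halfForm hA x).fderiv]
  simp only [FunLike.coe_sum, Finset.sum_apply, FunLike.coe_smul,
    Pi.smul_apply, ContinuousLinearMap.proj_apply, smul_eq_mul]
  rw [Finset.sum_eq_single i]
  · simp
  · intro j _ hj
    simp [hj]
  · simp

theorem isAntimonotonous_halfForm_iff {A : Matrix ι ι ℝ} (hA : A.IsSymm) :
    IsAntimonotonous (halfForm A) ↔ ∀ h : ι → ℝ, ∑ i, h i = 0 → 0 ≤ A *ᵥ h → h = 0 := by
  unfold IsAntimonotonous C Cplus Cminus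
  simp only [partialDeriv_halfForm hA, Set.eq_empty_iff_forall_notMem, Set.mem_union,
    Set.mem_ofPred_eq, not_or, not_and]
  constructor
  · intro H h hs hh
    by_contra hne
    exact (H h).1 hne hs hh
  · refine fun H h => ⟨fun hne hs hh => hne (H h hs hh), fun hne hs hh => hne ?_⟩
    have := H (-h) (by simp [hs]) (by intro i; simpa [mulVec_neg] using hh i)
    simpa using this

/-- A positive definite matrix `A` for which the solution `u` of `A u = (1, …, 1)` is strictly
positive. -/
def HasPositiveWeight (A : Matrix ι ι ℝ) : Prop :=
  A.PosDef ∧ ∃ u : ι → ℝ, (∀ i, 0 < u i) ∧ A *ᵥ u = 1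

theorem sum_eq_dotProduct_mulVec {A : Matrix ι ι ℝ} (hA : A.IsSymm) {u : ι → ℝ}
    (hu : A *ᵥ u = 1) (h : ι → ℝ) : ∑ i, h i = u ⬝ᵥ A *ᵥ h := by
  rw [dotProduct_mulVec_symm hA, hu, dotProduct_one]

/-- If A h ≥ 0 and Σ h_i = u · A h = 0 with u > 0, then A h = 0. -/
theorem HasPositiveWeight.isAntimonotonous {A : Matrix ι ι ℝ} (hA : A.IsSymm)
    (hW : HasPositiveWeight A) : IsAntimonotonous (halfForm A) := by
  rw [isAntimonotonous_halfForm_iff hA]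
  obtain ⟨hpd, u, hu, hAu⟩ := hW
  intro h hs hh
  rw [sum_eq_dotProduct_mulVec hA hAu, dotProduct,
    Finset.sum_eq_zero_iff_of_nonneg fun i _ => mul_nonneg (hu i).le (hh i)] at hs
  have h0 : A *ᵥ h = 0 := by
    funext i
    simpa [(hu i).ne'] using hs i (Finset.mem_univ i)
  by_contra hne
  have := hpd.dotProduct_mulVec_pos hne
  simp [h0] at this

/-- Antimonotonicity makes the kernel trivial, so semidefinite becomes definite. Then A⁻¹ y has
coordinate sum v · y with v = A⁻¹ 1, and a coordinate v_i ≤ 0 would allow a nonzero y ≥ 0 orthogonal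
to v. -/
theorem hasPositiveWeight_of_isAntimonotonous [Nonempty ι] {A : Matrix ι ι ℝ} (hA : A.IsSymm)
    (hone : ∀ i, 0 < (A *ᵥ 1) i) (hpsd : A.PosSemidef)
    (hanti : IsAntimonotonous (halfForm A)) : HasPositiveWeight A := by
  classical
  rw [isAntimonotonous_halfForm_iff hA] at hanti
  have hker : ∀ h : ι → ℝ, A *ᵥ h = 0 → h = 0 := by
    intro h hh
    by_cases hs : ∑ i, h i = 0
    · exact hanti h hs hh.ge
    · exfalso
      -- Subtracting a kernel vector scaled to the same coordinate sum turns the all-ones vector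
      -- into one of sum zero, without changing its positive image.
      have h1 : A *ᵥ (1 - ((Fintype.card ι : ℝ) / ∑ i, h i) • h) = A *ᵥ 1 := by
        rw [mulVec_sub, mulVec_smul, hh, smul_zero, sub_zero]
      have h2 := hanti (1 - ((Fintype.card ι : ℝ) / ∑ i, h i) • h) (by
        simp only [Pi.sub_apply, Pi.one_apply, Pi.smul_apply, smul_eq_mul, Finset.sum_sub_distrib,
          ← Finset.mul_sum, div_mul_cancel₀ _ hs]
        simp) (by rw [h1]; exact fun i => (hone i).le)
      rw [h2, mulVec_zero] at h1
      exact (hone (Classical.arbitrary ι)).ne (congrFun h1 _)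
  have hpd : A.PosDef := by
    refine PosDef.of_dotProduct_mulVec_pos hpsd.isHermitian fun x hx => ?_
    refine lt_of_le_of_ne (hpsd.dotProduct_mulVec_nonneg x) fun h => hx (hker x ?_)
    exact (hpsd.dotProduct_mulVec_zero_iff x).1 h.symm
  have hunit : IsUnit A.det := (isUnit_iff_isUnit_det A).1 hpd.isUnit
  have hinv : ∀ y, A *ᵥ (A⁻¹ *ᵥ y) = y := fun y => by
    rw [mulVec_mulVec, mul_nonsing_inv A hunit, one_mulVec]
  set v := A⁻¹ *ᵥ (1 : ι → ℝ) with hv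
  have hsum : ∀ y, ∑ i, (A⁻¹ *ᵥ y) i = v ⬝ᵥ y := fun y => by
    rw [sum_eq_dotProduct_mulVec hA (hinv 1), hinv]
  have hv0 : v ≠ 0 := fun h => by
    have := hinv 1
    rw [← hv, h, mulVec_zero] at this
    exact zero_ne_one (congrFun this (Classical.arbitrary ι))
  have hvs : 0 < ∑ i, v i := by
    rw [sum_eq_dotProduct_mulVec hA (hinv 1)]
    simpa using hpd.dotProduct_mulVec_pos hv0
  obtain ⟨j, -, hj⟩ := Finset.exists_lt_of_sum_lt (s := Finset.univ) (f := fun _ => (0 : ℝ))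
    (g := v) (by simpa using hvs)
  refine ⟨hpd, v, fun i => ?_, hinv 1⟩
  by_contra hi
  push Not at hi
  have hy := hanti (A⁻¹ *ᵥ (v j • Pi.single i 1 - v i • Pi.single j 1)) (by
    rw [hsum]
    simp [dotProduct_sub, mul_comm]) (by
    rw [hinv]
    intro k
    have h1 : (0 : ℝ) ≤ (Pi.single i 1 : ι → ℝ) k := by
      by_cases h : k = i <;> simp [h]
    have h2 : (0 : ℝ) ≤ (Pi.single j 1 : ι → ℝ) k := by
      by_cases h : k = j <;> simp [h]
    simp only [Pi.zero_apply, Pi.sub_apply, Pi.smul_apply, smul_eq_mul]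
    nlinarith [mul_nonneg hj.le h1, mul_nonneg (neg_nonneg.2 hi) h2])
  have h3 := hinv (v j • Pi.single i 1 - v i • Pi.single j 1)
  rw [hy, mulVec_zero] at h3
  have h4 := congrFun h3 i
  have hij : i ≠ j := fun h => by subst h; exact absurd hj (not_lt.2 hi)
  simp [hij] at h4
  exact hj.ne h4

theorem HasPositiveWeight.exists_isPFaithfulVector [Nonempty ι] {A : Matrix ι ι ℝ}
    (hA : A.IsSymm) (hW : HasPositiveWeight A) : ∃ u, IsPFaithfulVector (halfForm A) u := by
  obtain ⟨hpd, u, hu, hAu⟩ := hW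
  have hσ : 0 < ∑ i, u i := Finset.sum_pos (fun i _ => hu i) Finset.univ_nonempty
  set σ := ∑ i, u i with hσd
  have hf : ∀ x : ι → ℝ, x ≠ 0 → 0 < halfForm A x := fun x hx => by
    have := hpd.dotProduct_mulVec_pos hx
    simp only [star_trivial] at this
    exact half_pos this
  have hv : ∑ i, (σ⁻¹ • u) i = 1 := by
    simp only [Pi.smul_apply, smul_eq_mul, ← Finset.mul_sum, ← hσd]
    field_simp
  have hvpos : ∀ i, 0 < (σ⁻¹ • u) i := fun i => mul_pos (inv_pos.2 hσ) (hu i)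
  have hP : σ⁻¹ • u ∈ P ι := by
    refine ⟨fun i => ⟨hvpos i, ?_⟩, hv⟩
    rw [← hv]
    exact Finset.single_le_sum (f := (σ⁻¹ • u)) (fun j _ => (hvpos j).le) (Finset.mem_univ i)
  -- On the hyperplane of sum 1 the linear term of the expansion at the normalized weight vanishes,
  -- because A maps that weight to a constant vector.
  have hexp : ∀ w : ι → ℝ, ∑ i, w i = 1 →
      halfForm A w = halfForm A (σ⁻¹ • u) + halfForm A (w - σ⁻¹ • u) := fun w hw => by
    have h := halfForm_add_smul hA (σ⁻¹ • u) (w - σ⁻¹ • u) 1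
    rw [one_smul, add_sub_cancel, mulVec_smul, hAu, dotProduct_smul, dotProduct_one] at h
    simp only [Pi.sub_apply, Finset.sum_sub_distrib, hw, hv] at h
    simpa using h
  refine ⟨σ⁻¹ • u, hP, hf _ fun h => ?_, fun w hw => ?_⟩
  · have := hvpos (Classical.arbitrary ι)
    rw [h] at this
    exact lt_irrefl _ this
  · rw [hexp w hw.2]
    have hlt : w ≠ σ⁻¹ • u → 0 < halfForm A (w - σ⁻¹ • u) := fun h => hf _ (sub_ne_zero.2 h)
    refine ⟨?_, fun hwP => ?_⟩
    · by_cases h : w = σ⁻¹ • u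
      · simp [h, halfForm]
      · linarith [hlt h]
    · linarith [hlt fun h => hwP (h ▸ hP)]

/-- From an interior point of the simplex, every direction of coordinate sum zero leads to a point
of the boundary. -/
theorem exists_mem_Pbar_notMem_P {u h : ι → ℝ} (hu : u ∈ P ι) (h0 : h ≠ 0)
    (hs : ∑ i, h i = 0) :
    ∃ τ : ℝ, 0 < τ ∧ (∀ τ', 0 ≤ τ' → τ' ≤ τ → u + τ' • h ∈ Pbar ι) ∧ u + τ • h ∉ P ι := by
  classical
  obtain ⟨k, -, hk⟩ : ∃ k ∈ Finset.univ, h k < 0 := by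
    by_contra! hc
    refine h0 (funext fun i => ?_)
    exact (Finset.sum_eq_zero_iff_of_nonneg hc).1 hs i (Finset.mem_univ i)
  obtain ⟨m, hm, hmin⟩ := Finset.exists_min_image (Finset.univ.filter fun i => h i < 0)
    (fun i => u i / -h i) ⟨k, by simpa using hk⟩
  simp only [Finset.mem_filter, Finset.mem_univ, true_and] at hm hmin
  have hτ : 0 < u m / -h m := div_pos (hu.1 m).1 (by linarith)
  refine ⟨u m / -h m, hτ, fun τ' h1 h2 => ?_, fun hP => ?_⟩
  · have hsum : ∑ i, (u + τ' • h) i = 1 := by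
      simp only [Pi.add_apply, Pi.smul_apply, smul_eq_mul, Finset.sum_add_distrib,
        ← Finset.mul_sum, hs, hu.2, mul_zero, add_zero]
    have hnn : ∀ i, 0 ≤ (u + τ' • h) i := fun i => by
      simp only [Pi.add_apply, Pi.smul_apply, smul_eq_mul]
      rcases lt_or_ge (h i) 0 with hi | hi
      · have h3 := h2.trans (hmin i hi)
        rw [le_div_iff₀ (by linarith)] at h3
        linarith
      · have := (hu.1 i).1
        positivity
    refine ⟨fun i => ⟨hnn i, ?_⟩, hsum⟩
    rw [← hsum]
    exact Finset.single_le_sum (f := (u + τ' • h)) (fun j _ => hnn j) (Finset.mem_univ i)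
  · have := (hP.1 m).1
    simp only [Pi.add_apply, Pi.smul_apply, smul_eq_mul] at this
    rw [div_mul_eq_mul_div, div_neg, mul_div_cancel_right₀ _ hm.ne] at this
    linarith

/-- An interior minimum on the simplex makes A u constant, equal to c = 2 f(u) > 0. Strictness at
the boundary makes the form positive in the directions of sum zero, and these together with u span
the space orthogonally. -/
theorem hasPositiveWeight_of_isPFaithfulVector {A : Matrix ι ι ℝ} (hA : A.IsSymm)
    {u : ι → ℝ} (hu : IsPFaithfulVector (halfForm A) u) : HasPositiveWeight A := by
  classical
  obtain ⟨huP, hpos, hmin⟩ := hu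
  have hlin' : ∀ h : ι → ℝ, ∑ i, h i = 0 → 0 ≤ h ⬝ᵥ A *ᵥ u := by
    intro h hs
    by_cases h0 : h = 0
    · simp [h0]
    obtain ⟨τ, hτ, hbar, -⟩ := exists_mem_Pbar_notMem_P huP h0 hs
    by_contra! hneg
    set q := halfForm A h with hq
    set l := h ⬝ᵥ A *ᵥ u with hl
    -- So short a step that the quadratic term is at most half the linear decrease.
    set τ' := min τ (-l / (2 * (|q| + 1))) with hτ'
    have hτ'0 : 0 < τ' := lt_min hτ (by have := abs_nonneg q; apply div_pos <;> linarith)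
    have h1 := (hmin _ (hbar τ' hτ'0.le (min_le_left _ _))).1
    rw [halfForm_add_smul hA] at h1
    have h2 : τ' ≤ -l / (2 * (|q| + 1)) := min_le_right _ _
    rw [le_div_iff₀ (by positivity)] at h2
    have h3 : q ≤ |q| := le_abs_self q
    have h4 : 0 ≤ l + τ' * q := by
      by_contra! h5
      nlinarith
    nlinarith
  have hlin : ∀ h : ι → ℝ, ∑ i, h i = 0 → h ⬝ᵥ A *ᵥ u = 0 := fun h hs => by
    refine le_antisymm ?_ (hlin' h hs)
    have := hlin' (-h) (by simp [hs])
    rw [neg_dotProduct] at this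
    linarith
  have hposH : ∀ h : ι → ℝ, ∑ i, h i = 0 → h ≠ 0 → 0 < halfForm A h := by
    intro h hs h0
    obtain ⟨τ, hτ, hbar, hnP⟩ := exists_mem_Pbar_notMem_P huP h0 hs
    have h1 := (hmin _ (hbar τ hτ.le le_rfl)).2 hnP
    rw [halfForm_add_smul hA, hlin h hs] at h1
    have : 0 < τ ^ 2 * halfForm A h := by linarith
    exact (pos_iff_pos_of_mul_pos this).1 (by positivity)
  set c := 2 * halfForm A u with hc
  have hdot : ∀ x : ι → ℝ, x ⬝ᵥ A *ᵥ u = c * ∑ i, x i := by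
    intro x
    have h1 := hlin (x - (∑ i, x i) • u) (by
      simp [Finset.sum_sub_distrib, ← Finset.mul_sum, huP.2])
    rw [sub_dotProduct, smul_dotProduct, smul_eq_mul] at h1
    rw [hc, halfForm]
    linarith
  refine ⟨PosDef.of_dotProduct_mulVec_pos hA fun x hx => ?_, c⁻¹ • u, fun i => ?_, ?_⟩
  · have h1 := halfForm_add_smul hA (x - (∑ i, x i) • u) u (∑ i, x i)
    rw [sub_add_cancel, dotProduct_mulVec_symm hA, hdot] at h1
    have h2 : ∑ i, (x - (∑ i, x i) • u) i = 0 := by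
      simp [Finset.sum_sub_distrib, ← Finset.mul_sum, huP.2]
    rw [h2, mul_zero, mul_zero, add_zero] at h1
    have h3 : 0 < halfForm A x := by
      by_cases h4 : x - (∑ i, x i) • u = 0
      · have h5 : ∑ i, x i ≠ 0 := fun h => hx (by simpa [h] using h4)
        rw [h1, h4]
        have : (0 : ℝ) < (∑ i, x i) ^ 2 := by positivity
        have h6 : halfForm A 0 = 0 := by simp [halfForm]
        rw [h6]
        positivity
      · have := hposH _ h2 h4
        have h6 : 0 ≤ (∑ i, x i) ^ 2 * halfForm A u := by positivity
        linarith
    simp only [star_trivial]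
    unfold halfForm at h3
    linarith
  · exact mul_pos (inv_pos.2 (by linarith)) (huP.1 i).1
  · funext i
    have h1 := hdot (Pi.single i 1)
    simp only [single_dotProduct, one_mul, Finset.sum_pi_single', Finset.mem_univ, if_true,
      mul_one] at h1
    rw [mulVec_smul, Pi.smul_apply, h1, smul_eq_mul, Pi.one_apply, inv_mul_cancel₀]
    linarith

end QuadraticForms

/-! ### The form of a poset and its comparability matrix -/

section ComparabilityMatrix

variable (S : Type*) [PartialOrder S]

open Classical in
/-- The matrix with entries `2` on the diagonal, `1` at the other pairs of comparable elements, and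
`0` at the pairs of incomparable elements. -/
noncomputable def comparabilityMatrix (R : Type*) [AddMonoidWithOne R] : Matrix S S R :=
  fun s t => (if s ≤ t then 1 else 0) + (if t ≤ s then 1 else 0)

theorem comparabilityMatrix_isSymm (R : Type*) [AddCommMonoidWithOne R] :
    (comparabilityMatrix S R).IsSymm := by
  ext s t
  exact add_comm _ _

variable {S} in
open Classical in
theorem comparabilityMatrix_mulVec [Fintype S] (x : S → ℝ) (s : S) :
    (comparabilityMatrix S ℝ *ᵥ x) s = x s + ∑ t with (t ≤ s ∨ s ≤ t), x t := by
  have h : ∀ t, comparabilityMatrix S ℝ s t * x t =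
      (if t = s then x t else 0) + if (t ≤ s ∨ s ≤ t) then x t else 0 := by
    intro t
    unfold comparabilityMatrix
    by_cases h1 : s ≤ t <;> by_cases h2 : t ≤ s
    · simp [le_antisymm h1 h2]
      ring
    · have : t ≠ s := fun h => h2 h.le
      simp [h1, h2, this]
    · have : t ≠ s := fun h => h1 h.ge
      simp [h1, h2, this]
    · have : t ≠ s := fun h => h1 h.ge
      simp [h1, h2, this]
  simp only [mulVec, dotProduct, h, Finset.sum_add_distrib, Finset.sum_ite_eq', Finset.mem_univ,
    if_true, Finset.sum_filter]

theorem posetForm_eq_halfForm [Fintype S] :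
    posetForm S = halfForm (comparabilityMatrix S ℝ) := by
  classical
  funext x
  have h1 : posetForm S x = ∑ s, ∑ t, (if s ≤ t then 1 else 0) * (x s * x t) := by
    simp [posetForm, ite_mul]
  have h2 : posetForm S x = ∑ s, ∑ t, (if t ≤ s then 1 else 0) * (x s * x t) := by
    rw [h1, Finset.sum_comm]
    exact Finset.sum_congr rfl fun s _ => Finset.sum_congr rfl fun t _ => by rw [mul_comm (x t)]
  have h3 : x ⬝ᵥ comparabilityMatrix S ℝ *ᵥ x = posetForm S x + posetForm S x := by
    nth_rewrite 1 [h1]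
    rw [h2, ← Finset.sum_add_distrib]
    simp only [dotProduct, mulVec, Finset.mul_sum, ← Finset.sum_add_distrib]
    refine Finset.sum_congr rfl fun s _ => Finset.sum_congr rfl fun t _ => ?_
    unfold comparabilityMatrix
    ring
  rw [halfForm, h3]
  ring

theorem comparabilityMatrix_mulVec_one_pos [Fintype S] (s : S) :
    0 < (comparabilityMatrix S ℝ *ᵥ 1) s := by
  classical
  rw [comparabilityMatrix_mulVec]
  simp only [Pi.one_apply, Finset.sum_const, nsmul_eq_mul, mul_one]
  positivity

theorem isPFaithful_iff_hasPositiveWeight [Fintype S] [Nonempty S] :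
    IsPFaithful S ↔ HasPositiveWeight (comparabilityMatrix S ℝ) := by
  have hA := comparabilityMatrix_isSymm S ℝ
  unfold IsPFaithful
  rw [posetForm_eq_halfForm]
  exact ⟨fun ⟨u, hu⟩ => hasPositiveWeight_of_isPFaithfulVector hA hu,
    fun h => h.exists_isPFaithfulVector hA⟩

theorem isAntimonotonous_iff_hasPositiveWeight [Fintype S] [Nonempty S]
    (hpsd : ∀ x : S → ℝ, 0 ≤ posetForm S x) :
    IsAntimonotonous (posetForm S) ↔ HasPositiveWeight (comparabilityMatrix S ℝ) := by
  have hA := comparabilityMatrix_isSymm S ℝ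
  rw [posetForm_eq_halfForm] at hpsd ⊢
  refine ⟨fun h => hasPositiveWeight_of_isAntimonotonous hA
    (comparabilityMatrix_mulVec_one_pos S) ?_ h, fun h => h.isAntimonotonous hA⟩
  refine PosSemidef.of_dotProduct_mulVec_nonneg hA fun x => ?_
  have := hpsd x
  unfold halfForm at this
  simp only [star_trivial]
  linarith

end ComparabilityMatrix

/-! ### Determinants and dual norms of integral lattices; the claw and the diamond -/

section IntegralMatrices

/-- The integral matrix `B`, regarded as a real matrix. -/
def toReal {n : Type*} (B : Matrix n n ℤ) : Matrix n n ℝ := B.map (Int.castRingHom ℝ)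

/-- Every nonzero vector of the dual of the lattice with Gram matrix `B` has norm at least `1`. -/
def DualNormGeOne {n : Type*} [Fintype n] (B : Matrix n n ℤ) : Prop :=
  ∀ (x : n → ℝ) (y : n → ℤ), y ≠ 0 → (toReal B *ᵥ x = fun i => (y i : ℝ)) →
    1 ≤ x ⬝ᵥ toReal B *ᵥ x

theorem det_toReal {n : Type*} [Fintype n] [DecidableEq n] (B : Matrix n n ℤ) :
    (toReal B).det = B.det := ((Int.castRingHom ℝ).map_det B).symm

/-- The matrix `B` bordered by the vector `c` and the diagonal entry `2`. -/
def border {n : Type*} (B : Matrix n n ℤ) (c : n → ℤ) : Matrix (n ⊕ Unit) (n ⊕ Unit) ℤ :=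
  fromBlocks B (replicateCol Unit c) (replicateRow Unit c) (of fun _ _ => 2)

theorem toReal_border {n : Type*} (B : Matrix n n ℤ) (c : n → ℤ) :
    toReal (border B c) = fromBlocks (toReal B) (replicateCol Unit fun i => (c i : ℝ))
      (replicateRow Unit fun i => (c i : ℝ)) (of fun _ _ => 2) := by
  ext (i | i) (j | j) <;> simp [toReal, border]

theorem toReal_border_mulVec {n : Type*} [Fintype n] (B : Matrix n n ℤ) (c : n → ℤ)
    (x : n → ℝ) (t : ℝ) : toReal (border B c) *ᵥ (Sum.elim x fun _ => t) =
      Sum.elim (toReal B *ᵥ x + t • fun i => (c i : ℝ))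
        fun _ => (fun i => (c i : ℝ)) ⬝ᵥ x + 2 * t := by
  rw [toReal_border, fromBlocks_mulVec]
  funext i
  rcases i with i | i <;> simp [mulVec, dotProduct, mul_comm]

/-- With ξ = B⁻¹ c, the norm of (x, t) splits as |x + t ξ|² + t² d, where d = 2 - ξ · c is the Schur
complement. Since ξ is a nonzero dual vector, d ≤ 1, which gives the determinant bound. A dual
vector has either a nonzero B-component, of norm at least 1, or x = -t ξ with t d a nonzero integer,
and then t² d = (t d)² / d ≥ 1. -/
theorem DualNormGeOne.border {n : Type*} [Fintype n] [DecidableEq n] {B : Matrix n n ℤ}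
    (hsymm : (toReal B).IsSymm) (hB : DualNormGeOne B) (c : n → ℤ) (hc : c ≠ 0)
    (hpd : (toReal B).PosDef) (hpd' : (toReal (border B c)).PosDef) :
    DualNormGeOne (border B c) ∧ (AntimonotonousPosets.border B c).det ≤ B.det := by
  have hunit : IsUnit (toReal B).det := (isUnit_iff_isUnit_det _).1 hpd.isUnit
  set c' : n → ℝ := fun i => (c i : ℝ) with hc'
  set ξ : n → ℝ := (toReal B)⁻¹ *ᵥ c' with hξ
  have hBξ : toReal B *ᵥ ξ = c' := by
    rw [hξ, mulVec_mulVec, mul_nonsing_inv _ hunit, one_mulVec]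
  have h1 : 1 ≤ ξ ⬝ᵥ c' := hBξ ▸ hB ξ c hc hBξ
  set d : ℝ := 2 - ξ ⬝ᵥ c' with hd
  have hd0 : 0 < d := by
    have hne : (Sum.elim (-ξ) fun _ => (1 : ℝ)) ≠ (0 : n ⊕ Unit → ℝ) := fun h => by
      simpa using congrFun h (Sum.inr ())
    have := hpd'.dotProduct_mulVec_pos hne
    rw [star_trivial, toReal_border_mulVec, sumElim_dotProduct_sumElim, ← hc', mulVec_neg, hBξ,
      one_smul, neg_add_cancel, dotProduct_zero, dotProduct_neg, dotProduct_comm] at this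
    simp [dotProduct] at this
    have hcomm : ξ ⬝ᵥ c' = ∑ i, c' i * ξ i := dotProduct_comm ξ c'
    rw [hd, hcomm]
    linarith
  have hnorm : ∀ (x : n → ℝ) (t : ℝ), (Sum.elim x fun _ => t) ⬝ᵥ
      (toReal (AntimonotonousPosets.border B c) *ᵥ (Sum.elim x fun _ => t)) =
      (x + t • ξ) ⬝ᵥ toReal B *ᵥ (x + t • ξ) + t ^ 2 * d := by
    intro x t
    have e1 : ξ ⬝ᵥ toReal B *ᵥ x = x ⬝ᵥ c' := by
      rw [dotProduct_mulVec_symm hsymm, hBξ]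
    have e2 : (fun _ : Unit => t) ⬝ᵥ (fun _ => c' ⬝ᵥ x + 2 * t) = t * (x ⬝ᵥ c' + 2 * t) := by
      rw [dotProduct_comm c' x]
      simp [dotProduct]
    rw [toReal_border_mulVec, sumElim_dotProduct_sumElim, ← hc', e2]
    simp only [mulVec_add, mulVec_smul, hBξ, dotProduct_add, add_dotProduct, dotProduct_smul,
      smul_dotProduct, smul_eq_mul, e1, hd]
    ring
  refine ⟨fun x' y hy hxy => ?_, ?_⟩
  · obtain ⟨x, t, rfl⟩ : ∃ (x : n → ℝ) (t : ℝ), x' = Sum.elim x fun _ => t :=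
      ⟨fun i => x' (Sum.inl i), x' (Sum.inr ()), by funext i; rcases i with i | i <;> rfl⟩
    rw [hnorm]
    rw [toReal_border_mulVec] at hxy
    have hz : toReal B *ᵥ (x + t • ξ) = fun i => (y (Sum.inl i) : ℝ) := by
      funext i
      have := congrFun hxy (Sum.inl i)
      rw [mulVec_add, mulVec_smul, hBξ]
      simpa using this
    by_cases hy1 : (fun i => y (Sum.inl i)) = 0
    · have hz0 : x + t • ξ = 0 := by
        by_contra hne
        have h2 := hpd.dotProduct_mulVec_pos hne
        have h3 : (fun i => (y (Sum.inl i) : ℝ)) = 0 := by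
          funext i
          simpa using congrFun hy1 i
        rw [hz, h3, dotProduct_zero] at h2
        exact lt_irrefl _ h2
      have hx : x = -(t • ξ) := eq_neg_of_add_eq_zero_left hz0
      have hy2 : y (Sum.inr ()) ≠ 0 := fun h => hy (by
        funext i
        rcases i with i | i
        · exact congrFun hy1 i
        · exact h)
      have h2 := congrFun hxy (Sum.inr ())
      simp only [Sum.elim_inr, ← hc', hx, dotProduct_neg, dotProduct_smul, smul_eq_mul] at h2
      rw [dotProduct_comm] at h2
      have h3 : t * d = y (Sum.inr ()) := by rw [← h2, hd]; ring
      have h4 : (1 : ℝ) ≤ (t * d) ^ 2 := by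
        rw [h3]
        have : 1 ≤ (y (Sum.inr ())) ^ 2 := by
          have := sq_pos_of_ne_zero hy2
          linarith
        exact_mod_cast this
      rw [hz0, zero_dotProduct, zero_add]
      have h5 : d ≤ 1 := by linarith
      have h6 : t ^ 2 * d * d ≤ t ^ 2 * d * 1 :=
        mul_le_mul_of_nonneg_left h5 (by positivity)
      nlinarith
    · have := hB _ _ hy1 hz
      have : 0 ≤ t ^ 2 * d := by positivity
      linarith
  · have hdet : (toReal (AntimonotonousPosets.border B c)).det = (toReal B).det * d := by
      let _ := invertibleOfIsUnitDet _ hunit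
      rw [toReal_border, det_fromBlocks₁₁, invOf_eq_nonsing_inv]
      congr 1
      rw [det_unique]
      rw [Matrix.mul_assoc, ← replicateCol_mulVec, Matrix.sub_apply,
        replicateRow_mul_replicateCol_apply, ← hc', ← hξ, dotProduct_comm, hd, of_apply]
    have h2 : (toReal (AntimonotonousPosets.border B c)).det ≤ (toReal B).det := by
      rw [hdet]
      have := hpd.det_pos
      nlinarith
    rw [det_toReal, det_toReal] at h2
    exact_mod_cast h2

theorem submatrix_sumElim {n S : Type*} {A : Matrix S S ℤ} (hA : A.IsSymm)
    (hdiag : ∀ s, A s s = 2) (e : n → S) (v : S) :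
    A.submatrix (Sum.elim e fun _ : Unit => v) (Sum.elim e fun _ => v) =
      border (A.submatrix e e) fun i => A (e i) v := by
  ext (i | i) (j | j)
  · rfl
  · rfl
  · exact hA.apply _ _
  · exact hdiag v

/-- A connected positive definite integral matrix with diagonal entries `2` has a determinant at
most that of any principal submatrix whose dual lattice has minimal norm at least `1`. -/
theorem det_le_det_submatrix {S : Type*} [Fintype S] [DecidableEq S] {A : Matrix S S ℤ}
    (hA : A.IsSymm) (hdiag : ∀ s, A s s = 2) (hpd : (toReal A).PosDef)
    (hconn : ∀ T : Set S, T.Nonempty → T ≠ Set.univ → ∃ s ∈ T, ∃ v ∉ T, A s v ≠ 0) (k : ℕ) :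
    ∀ (n : Type) [Fintype n] [DecidableEq n] [Nonempty n] (e : n → S), Function.Injective e →
      Fintype.card S = Fintype.card n + k → DualNormGeOne (A.submatrix e e) →
      A.det ≤ (A.submatrix e e).det := by
  induction k with
  | zero =>
    intro n _ _ _ e he hcard _
    have hbij : Function.Bijective e :=
      (Fintype.bijective_iff_injective_and_card e).2 ⟨he, by omega⟩
    exact (det_submatrix_equiv_self (Equiv.ofBijective e hbij) A).ge
  | succ k ih =>
    intro n _ _ _ e he hcard hdual
    -- The new element is chosen comparable to an old one, so that the bordering vector is nonzero.
    obtain ⟨s, ⟨i, rfl⟩, v, hv, hsv⟩ := hconn (Set.range e) (Set.range_nonempty e) (fun h => by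
      have := Fintype.card_le_of_surjective e (Set.range_eq_univ.1 h)
      omega)
    have he' : Function.Injective (Sum.elim e fun _ : Unit => v) :=
      he.sumElim (Function.injective_of_subsingleton _) fun a _ h => hv ⟨a, h⟩
    have hsub : ∀ {m : Type} (g : m → S),
        toReal (A.submatrix g g) = (toReal A).submatrix g g := fun _ => rfl
    have hstep := hdual.border (c := fun i => A (e i) v)
      (by rw [hsub]; exact IsSymm.submatrix hpd.isHermitian e) (fun h => hsv (congrFun h i))
      (by rw [hsub]; exact hpd.submatrix he)
      (by rw [← submatrix_sumElim hA hdiag, hsub]; exact hpd.submatrix he')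
    rw [← submatrix_sumElim hA hdiag] at hstep
    exact (ih _ _ he' (by simp; omega) hstep.1).trans hstep.2

/-- The coordinates of the solution of `A u = (1, …, 1)` become integral when multiplied by
`det A`. -/
theorem exists_int_det_mul {S : Type*} [Fintype S] [DecidableEq S] (A : Matrix S S ℤ)
    {u : S → ℝ} (hu : toReal A *ᵥ u = 1) (s : S) : ∃ k : ℤ, A.det * u s = k := by
  have h : (toReal A).adjugate *ᵥ (toReal A *ᵥ u) = (toReal A).det • u := by
    rw [mulVec_mulVec, adjugate_mul, smul_mulVec, one_mulVec]
  have h2 : (toReal A).adjugate = toReal A.adjugate := ((Int.castRingHom ℝ).map_adjugate A).symm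
  rw [hu, h2, det_toReal] at h
  refine ⟨∑ t, A.adjugate s t, ?_⟩
  have := congrFun h s
  simp only [mulVec, dotProduct_one, toReal, map_apply, Pi.smul_apply, smul_eq_mul] at this
  rw [← this]
  simp

/-- All numbers det A · u_s are positive integers, so the row of `b` multiplied by det A yields det
A ≥ 2 + 3. -/
theorem four_lt_det_of_three_neighbours {S : Type*} [Fintype S] [DecidableEq S]
    {A : Matrix S S ℤ} (hdiag : ∀ s, A s s = 2) (hnn : ∀ s t, 0 ≤ A s t)
    (hW : HasPositiveWeight (toReal A)) (b : S) (T : Finset S) (hb : b ∉ T) (hT : T.card = 3)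
    (hadj : ∀ t ∈ T, 1 ≤ A b t) : 4 < A.det := by
  obtain ⟨hpd, u, hu, hAu⟩ := hW
  have hdet : (0 : ℝ) < A.det := by
    rw [← det_toReal]
    exact hpd.det_pos
  have hge : ∀ s, 1 ≤ A.det * u s := fun s => by
    obtain ⟨k, hk⟩ := exists_int_det_mul A hAu s
    have h1 := mul_pos hdet (hu s)
    rw [hk] at h1 ⊢
    have : 0 < k := by exact_mod_cast h1
    exact_mod_cast this
  have h1 : ∑ t ∈ insert b T, (A b t : ℝ) * u t ≤ 1 := by
    have := congrFun hAu b
    rw [Pi.one_apply] at this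
    rw [← this]
    refine Finset.sum_le_sum_of_subset_of_nonneg (Finset.subset_univ _) fun t _ _ => ?_
    exact mul_nonneg (by exact_mod_cast hnn b t) (hu t).le
  rw [Finset.sum_insert hb, hdiag] at h1
  have h2 : ∑ t ∈ T, u t ≤ ∑ t ∈ T, (A b t : ℝ) * u t := Finset.sum_le_sum fun t ht => by
    have : (1 : ℝ) ≤ A b t := by exact_mod_cast hadj t ht
    nlinarith [hu t]
  have h3 : (3 : ℝ) ≤ A.det * ∑ t ∈ T, u t := by
    rw [Finset.mul_sum]
    calc (3 : ℝ) = ∑ t ∈ T, 1 := by simp [hT]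
      _ ≤ _ := Finset.sum_le_sum fun t _ => hge t
  have h4 := hge b
  have h5 : (4 : ℝ) < A.det := by
    push_cast at h1
    nlinarith
  exact_mod_cast h5

/-- A sum of squares has the parity of the sum. In suitable coordinates the dual norms of the claw
and of the diamond are half of such a sum. -/
theorem two_le_sum_four_sq {p q r t : ℤ} (heven : Even (p + q + r + t))
    (hne : ¬(p = 0 ∧ q = 0 ∧ r = 0 ∧ t = 0)) : 2 ≤ p ^ 2 + q ^ 2 + r ^ 2 + t ^ 2 := by
  have h1 : Even (p ^ 2 + q ^ 2 + r ^ 2 + t ^ 2) := by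
    simpa [Int.even_add, Int.even_pow] using heven
  have h2 : 0 < p ^ 2 + q ^ 2 + r ^ 2 + t ^ 2 := by
    by_contra! h
    refine hne ⟨?_, ?_, ?_, ?_⟩ <;> nlinarith [sq_nonneg p, sq_nonneg q, sq_nonneg r, sq_nonneg t]
  obtain ⟨m, hm⟩ := h1
  omega

/-- The Gram matrix of the claw. -/
def clawMatrix : Matrix (Fin 4) (Fin 4) ℤ := !![2, 1, 1, 1; 1, 2, 0, 0; 1, 0, 2, 0; 1, 0, 0, 2]

/-- The Gram matrix of the diamond. -/
def diamondMatrix : Matrix (Fin 4) (Fin 4) ℤ :=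
  !![2, 1, 1, 1; 1, 2, 1, 1; 1, 1, 2, 0; 1, 1, 0, 2]

theorem det_clawMatrix : clawMatrix.det = 4 := by decide

theorem det_diamondMatrix : diamondMatrix.det = 4 := by decide

theorem dualNormGeOne_clawMatrix : DualNormGeOne clawMatrix := by
  intro x y hy hxy
  have h0 := congrFun hxy 0
  have h1 := congrFun hxy 1
  have h2 := congrFun hxy 2
  have h3 := congrFun hxy 3
  rw [hxy]
  simp [toReal, clawMatrix, mulVec, dotProduct, Fin.sum_univ_four] at h0 h1 h2 h3
  -- Twice the first row minus the other three isolates `x 0`, which is therefore an integer.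
  have hb : x 0 = ((2 * y 0 - y 1 - y 2 - y 3 : ℤ) : ℝ) := by
    push_cast
    linarith
  have key := two_le_sum_four_sq (p := 2 * y 0 - y 1 - y 2 - y 3) (q := y 1) (r := y 2) (t := y 3)
    ⟨y 0, by ring⟩ (by
      rintro ⟨e0, e1, e2, e3⟩
      refine hy (funext fun i => ?_)
      fin_cases i <;> simp <;> omega)
  have key' : (2 : ℝ) ≤ ((2 * y 0 - y 1 - y 2 - y 3 : ℤ) : ℝ) ^ 2 + (y 1 : ℝ) ^ 2 +
    (y 2 : ℝ) ^ 2 + (y 3 : ℝ) ^ 2 := by exact_mod_cast key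
  have e1 : x 1 = (y 1 - x 0) / 2 := by linarith
  have e2 : x 2 = (y 2 - x 0) / 2 := by linarith
  have e3 : x 3 = (y 3 - x 0) / 2 := by linarith
  simp only [dotProduct, Fin.sum_univ_four]
  rw [e1, e2, e3, hb]
  push_cast at key' ⊢
  linarith

theorem dualNormGeOne_diamondMatrix : DualNormGeOne diamondMatrix := by
  intro x y hy hxy
  have h0 := congrFun hxy 0
  have h1 := congrFun hxy 1
  have h2 := congrFun hxy 2
  have h3 := congrFun hxy 3
  rw [hxy]
  simp [toReal, diamondMatrix, mulVec, dotProduct, Fin.sum_univ_four] at h0 h1 h2 h3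
  -- These coordinates diagonalize the dual form: x · y is half the sum of their squares.
  have key := two_le_sum_four_sq (p := y 0 + y 1 - y 2 - y 3) (q := y 0 - y 1) (r := y 2)
    (t := y 3) ⟨y 0, by ring⟩ (by
      rintro ⟨e0, e1, e2, e3⟩
      refine hy (funext fun i => ?_)
      fin_cases i <;> simp <;> omega)
  have key' : (2 : ℝ) ≤ ((y 0 + y 1 - y 2 - y 3 : ℤ) : ℝ) ^ 2 + ((y 0 - y 1 : ℤ) : ℝ) ^ 2 +
    (y 2 : ℝ) ^ 2 + (y 3 : ℝ) ^ 2 := by exact_mod_cast key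
  have e0 : x 0 = ((y 0 + y 1 - y 2 - y 3) + (y 0 - y 1)) / 2 := by linarith
  have e1 : x 1 = ((y 0 + y 1 - y 2 - y 3) - (y 0 - y 1)) / 2 := by linarith
  have e2 : x 2 = (y 2 - (y 0 + y 1 - y 2 - y 3)) / 2 := by linarith
  have e3 : x 3 = (y 3 - (y 0 + y 1 - y 2 - y 3)) / 2 := by linarith
  simp only [dotProduct, Fin.sum_univ_four]
  rw [e1, e2, e3, e0]
  push_cast at key' ⊢
  linarith

end IntegralMatrices

/-! ### The comparability graph has no induced claw or diamond -/

section Comparability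

variable {S : Type*} [PartialOrder S]

/-- `x` and `y` are comparable. -/
def Cmp (x y : S) : Prop := x ≤ y ∨ y ≤ x

theorem Cmp.refl (x : S) : Cmp x x := Or.inl le_rfl

theorem Cmp.symm {x y : S} (h : Cmp x y) : Cmp y x := Or.symm h

theorem Cmp.lt_or_gt {x y : S} (h : Cmp x y) (hne : x ≠ y) : x < y ∨ y < x :=
  h.imp (fun h => lt_of_le_of_ne h hne) fun h => lt_of_le_of_ne h hne.symm

theorem comparabilityMatrix_self (s : S) : comparabilityMatrix S ℤ s s = 2 := by
  simp [comparabilityMatrix]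

theorem comparabilityMatrix_of_cmp {s t : S} (h : Cmp s t) (hne : s ≠ t) :
    comparabilityMatrix S ℤ s t = 1 := by
  rcases h.lt_or_gt hne with h | h <;> simp [comparabilityMatrix, h.le, h.not_ge]

theorem comparabilityMatrix_of_not_cmp {s t : S} (h : ¬Cmp s t) :
    comparabilityMatrix S ℤ s t = 0 := by
  unfold Cmp at h
  push Not at h
  simp [comparabilityMatrix, h.1, h.2]

theorem toReal_comparabilityMatrix :
    toReal (comparabilityMatrix S ℤ) = comparabilityMatrix S ℝ := by
  ext s t
  simp [toReal, comparabilityMatrix]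

/-- A set closed under comparability in a poset with connected Hasse graph is everything. -/
theorem eq_univ_of_closed_under_cmp [Finite S] (hconn : (SimpleGraph.hasse S).Connected)
    {T : Set S} (hT : T.Nonempty) (hcl : ∀ s ∈ T, ∀ t, Cmp s t → t ∈ T) : T = Set.univ := by
  obtain ⟨s, hs⟩ := hT
  refine Set.eq_univ_of_forall fun t => ?_
  obtain ⟨w⟩ := hconn.preconnected s t
  induction w with
  | nil => exact hs
  | cons hadj _ ih =>
    refine ih (hcl _ hs _ ?_)
    rw [SimpleGraph.hasse_adj] at hadj
    exact hadj.imp (fun h => h.le) fun h => h.le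

theorem four_lt_det_comparabilityMatrix [Fintype S] [DecidableEq S]
    (hW : HasPositiveWeight (comparabilityMatrix S ℝ)) {b c d e : S} (hbc : Cmp b c)
    (hbd : Cmp b d) (hbe : Cmp b e) (h1 : b ≠ c) (h2 : b ≠ d) (h3 : b ≠ e) (h4 : c ≠ d)
    (h5 : c ≠ e) (h6 : d ≠ e) : 4 < (comparabilityMatrix S ℤ).det := by
  rw [← toReal_comparabilityMatrix] at hW
  refine four_lt_det_of_three_neighbours comparabilityMatrix_self (fun s t => ?_) hW b {c, d, e}
    (by simp [h1, h2, h3]) (by simp [h4, h5, h6]) fun t ht => ?_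
  · unfold comparabilityMatrix
    positivity
  · simp only [Finset.mem_insert, Finset.mem_singleton] at ht
    rcases ht with rfl | rfl | rfl
    · exact (comparabilityMatrix_of_cmp hbc h1).ge
    · exact (comparabilityMatrix_of_cmp hbd h2).ge
    · exact (comparabilityMatrix_of_cmp hbe h3).ge

theorem det_comparabilityMatrix_le [Fintype S] [DecidableEq S]
    (hconn : (SimpleGraph.hasse S).Connected)
    (hW : HasPositiveWeight (comparabilityMatrix S ℝ)) {e : Fin 4 → S}
    (he : Function.Injective e) {B : Matrix (Fin 4) (Fin 4) ℤ} (hB : DualNormGeOne B)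
    (hsub : (comparabilityMatrix S ℤ).submatrix e e = B) :
    (comparabilityMatrix S ℤ).det ≤ B.det := by
  subst hsub
  refine det_le_det_submatrix (comparabilityMatrix_isSymm S ℤ) comparabilityMatrix_self
    (by rw [toReal_comparabilityMatrix]; exact hW.1) (fun T hT hne => ?_)
    (Fintype.card S - Fintype.card (Fin 4)) (Fin 4) e he ?_ hB
  · by_contra! h
    refine hne (eq_univ_of_closed_under_cmp hconn hT fun s hs t hst => ?_)
    by_contra ht
    have hst' : s ≠ t := fun h => ht (h ▸ hs)
    have := h s hs t ht
    rw [comparabilityMatrix_of_cmp hst hst'] at this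
    exact one_ne_zero this
  · have := Fintype.card_le_of_injective e he
    omega

/-- The comparability graph has no induced claw. -/
theorem HasPositiveWeight.no_claw [Fintype S] (hconn : (SimpleGraph.hasse S).Connected)
    (hW : HasPositiveWeight (comparabilityMatrix S ℝ)) {b c d e : S} (hbc : Cmp b c)
    (hbd : Cmp b d) (hbe : Cmp b e) (hcd : ¬Cmp c d) (hce : ¬Cmp c e) : Cmp d e := by
  classical
  by_contra hde
  have hbc' : b ≠ c := by rintro rfl; exact hcd hbd
  have hbd' : b ≠ d := by rintro rfl; exact hde hbe
  have hbe' : b ≠ e := by rintro rfl; exact hde hbd.symm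
  have hne : ∀ {x y : S}, ¬Cmp x y → x ≠ y := by rintro x y h rfl; exact h (Cmp.refl x)
  -- The centre of the claw has three neighbours, so the determinant exceeds 4, against the bound by
  -- the determinant of the claw.
  have hdet := four_lt_det_comparabilityMatrix hW hbc hbd hbe hbc' hbd' hbe' (hne hcd) (hne hce)
    (hne hde)
  have hle := det_comparabilityMatrix_le hconn hW (e := ![b, c, d, e]) ?_ dualNormGeOne_clawMatrix ?_
  · rw [det_clawMatrix] at hle
    exact absurd hdet (not_lt.2 hle)
  · intro i j hij
    fin_cases i <;> fin_cases j <;> simp_all [eq_comm]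
  · have hsymm : ∀ {x y : S}, ¬Cmp x y → ¬Cmp y x := fun h h' => h h'.symm
    ext i j
    fin_cases i <;> fin_cases j <;>
      simp [clawMatrix, comparabilityMatrix_self, comparabilityMatrix_of_cmp,
        comparabilityMatrix_of_not_cmp, hbc, hbd, hbe, hbc.symm, hbd.symm, hbe.symm, hbc', hbd',
        hbe', hbc'.symm, hbd'.symm, hbe'.symm, hcd, hce, hde, hsymm hcd, hsymm hce, hsymm hde]

/-- The comparability graph has no induced diamond. -/
theorem HasPositiveWeight.no_diamond [Fintype S] (hconn : (SimpleGraph.hasse S).Connected)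
    (hW : HasPositiveWeight (comparabilityMatrix S ℝ)) {a b c d : S} (hab : Cmp a b)
    (hne : a ≠ b) (hac : Cmp a c) (had : Cmp a d) (hbc : Cmp b c) (hbd : Cmp b d) : Cmp c d := by
  classical
  by_contra hcd
  have hac' : a ≠ c := by rintro rfl; exact hcd had
  have had' : a ≠ d := by rintro rfl; exact hcd hac.symm
  have hbc' : b ≠ c := by rintro rfl; exact hcd hbd
  have hbd' : b ≠ d := by rintro rfl; exact hcd hbc.symm
  have hcd' : c ≠ d := by rintro rfl; exact hcd (Cmp.refl c)
  have hdet := four_lt_det_comparabilityMatrix hW hab hac had hne hac' had' hbc' hbd' hcd'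
  have hle := det_comparabilityMatrix_le hconn hW (e := ![a, b, c, d]) ?_
    dualNormGeOne_diamondMatrix ?_
  · rw [det_diamondMatrix] at hle
    exact absurd hdet (not_lt.2 hle)
  · intro i j hij
    fin_cases i <;> fin_cases j <;> simp_all [eq_comm]
  · have hcd2 : ¬Cmp d c := fun h => hcd h.symm
    ext i j
    fin_cases i <;> fin_cases j <;>
      simp [diamondMatrix, comparabilityMatrix_self, comparabilityMatrix_of_cmp,
        comparabilityMatrix_of_not_cmp, hab, hac, had, hbc, hbd, hab.symm, hac.symm, had.symm,
        hbc.symm, hbd.symm, hne, hac', had', hbc', hbd', hne.symm, hac'.symm, had'.symm,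
        hbc'.symm, hbd'.symm, hcd, hcd2]

end Comparability

/-! ### Finite paths -/

section Enumeration

/-- A functional and injective relation on a finite type which is connected and is not a cycle
enumerates the type. -/
theorem exists_enumeration {V : Type*} [Finite V] [Nonempty V] (R : V → V → Prop)
    (hfun : ∀ x y z, R x y → R x z → y = z) (hinj : ∀ x y z, R x z → R y z → x = y)
    (hend : ∃ v, (∀ x, ¬R x v) ∨ ∀ x, ¬R v x)
    (hconn : ∀ T : Set V, T.Nonempty → (∀ x y, R x y → (x ∈ T ↔ y ∈ T)) → T = Set.univ) :
    ∃ (t : ℕ) (e : Fin t ≃ V), ∀ i j, R (e i) (e j) ↔ (i : ℕ) + 1 = j := by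
  classical
  have := Fintype.ofFinite V
  -- If every element had a predecessor, the predecessor map would be injective, hence surjective,
  -- and every element would have a successor too, against `hend`.
  obtain ⟨v₀, hv₀⟩ : ∃ v, ∀ x, ¬R x v := by
    by_contra! hpred
    choose g hg using hpred
    have hginj : Function.Injective g := fun a b hab => hfun (g a) a b (hg a) (hab ▸ hg b)
    have hgsurj := Finite.surjective_of_injective hginj
    obtain ⟨v, hv | hv⟩ := hend
    · exact hv _ (hg v)
    · obtain ⟨w, rfl⟩ := hgsurj v
      exact hv _ (hg w)
  -- A longest `R`-path from the starting point is closed under `R` in both directions, so it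
  -- exhausts the type.
  let Q : ℕ → Prop := fun n => ∃ l : List V,
    l.length = n ∧ l.Nodup ∧ l.head? = some v₀ ∧ l.IsChain R
  have hbound : ∀ n, Q n → n ≤ Fintype.card V := by
    rintro n ⟨l, rfl, hl, -⟩
    exact hl.length_le_card
  have hQ1 : Q 1 := ⟨[v₀], rfl, by simp, rfl, by simp⟩
  obtain ⟨l, hlen, hnd, hhead, hchain⟩ := Nat.findGreatest_spec (hbound 1 hQ1) hQ1
  have hmax : ∀ n, Q n → n ≤ l.length := fun n hn => by
    rw [hlen]
    exact Nat.le_findGreatest (hbound n hn) hn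
  have hne : l ≠ [] := by
    rintro rfl
    simp at hhead
  have hstep : ∀ (i : ℕ) (h : i + 1 < l.length), R l[i] l[i + 1] :=
    fun i h => List.isChain_iff_getElem.1 hchain i h
  have hpos : 0 < l.length := List.length_pos_iff.2 hne
  have h0 : l[0] = v₀ := by
    rw [List.head?_eq_getElem?, List.getElem?_eq_getElem hpos] at hhead
    exact Option.some.inj hhead
  have hpredmem : ∀ (x : V) (j : ℕ) (hj : j < l.length), R x l[j] →
      ∃ i, ∃ hi : i + 1 = j, x = l[i] := by
    intro x j hj hR
    cases j with
    | zero => exact absurd (h0 ▸ hR) (hv₀ x)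
    | succ i => exact ⟨i, rfl, hinj _ _ _ hR (hstep i hj)⟩
  have huniv : {x | x ∈ l} = Set.univ := by
    refine hconn _ ⟨l[0], List.getElem_mem hpos⟩ fun x y hxy => ⟨fun hx => ?_, fun hy => ?_⟩
    · obtain ⟨i, hi, rfl⟩ := List.getElem_of_mem hx
      by_cases hi' : i + 1 < l.length
      · rw [hfun _ _ _ hxy (hstep i hi')]
        exact List.getElem_mem hi'
      · by_contra hy
        have : Q (l.length + 1) := by
          refine ⟨l ++ [y], by simp, ?_, ?_, ?_⟩
          · rw [List.nodup_append]
            refine ⟨hnd, by simp, ?_⟩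
            intro a ha b hb
            rw [List.mem_singleton] at hb
            subst hb
            rintro rfl
            exact hy ha
          · rw [List.head?_append_of_ne_nil _ hne, hhead]
          · rw [List.isChain_append]
            refine ⟨hchain, by simp, ?_⟩
            intro a ha b hb
            have hb' : b = y := by simpa [eq_comm] using hb
            have ha' : a = l[i] := by
              rw [List.getLast?_eq_getElem?, List.getElem?_eq_getElem (by omega)] at ha
              have hidx : l.length - 1 = i := by omega
              simp only [hidx] at ha
              simpa [eq_comm] using ha
            rw [ha', hb']
            exact hxy
        have := hmax _ this
        omega
    · obtain ⟨j, hj, rfl⟩ := List.getElem_of_mem hy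
      obtain ⟨i, hi, rfl⟩ := hpredmem x j hj hxy
      exact List.getElem_mem _
  refine ⟨l.length, Equiv.ofBijective (fun i : Fin l.length => l[i]) ⟨?_, ?_⟩, fun i j => ?_⟩
  · intro i j hij
    exact Fin.ext ((hnd.getElem_inj_iff).1 hij)
  · intro x
    have hx : x ∈ l := by
      have : x ∈ {x | x ∈ l} := huniv ▸ Set.mem_univ x
      exact this
    obtain ⟨i, hi, rfl⟩ := List.getElem_of_mem hx
    exact ⟨⟨i, hi⟩, rfl⟩
  · change R l[(i : ℕ)] l[(j : ℕ)] ↔ _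
    constructor
    · intro hR
      obtain ⟨k, hk, hk'⟩ := hpredmem _ _ j.2 hR
      have : (i : ℕ) = k := (hnd.getElem_inj_iff).1 hk'
      omega
    · intro hij
      have h := hstep i (by omega)
      have : l[(i : ℕ) + 1]'(by omega) = l[j] := by
        congr 1
      exact this ▸ h

end Enumeration

/-! ### Clique weights in a balanced poset -/

section WeightedPosets

theorem sum_le_of_three {ι : Type*} {F : Finset ι} {f : ι → ℝ} {x c d : ι} (hx : x ∈ F) (hc : c ∈ F)
    (hd : d ∈ F) (hxc : x ≠ c) (hxd : x ≠ d) (hcd : c ≠ d)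
    (h : ∀ t ∈ F, t ≠ x → t ≠ c → t ≠ d → f t ≤ 0) : ∑ t ∈ F, f t ≤ f x + f c + f d := by
  classical
  have h1 : ({x, c, d} : Finset ι) ⊆ F := by
    intro t ht
    simp only [Finset.mem_insert, Finset.mem_singleton] at ht
    rcases ht with rfl | rfl | rfl <;> assumption
  have h2 := Finset.sum_le_sum_of_subset_of_nonneg (f := fun t => -f t) h1 fun t ht ht' => by
    simp only [Finset.mem_insert, Finset.mem_singleton, not_or] at ht'
    have := h t ht ht'.1 ht'.2.1 ht'.2.2
    linarith
  rw [Finset.sum_neg_distrib, Finset.sum_neg_distrib, neg_le_neg_iff,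
    Finset.sum_insert (by simp [hxc, hxd]), Finset.sum_pair hcd] at h2
  linarith

open scoped Classical

variable {S : Type*} [Fintype S] [PartialOrder S]

/-- The elements comparable to both `x` and `y`. -/
noncomputable def commonCmp (x y : S) : Finset S := {z | Cmp z x ∧ Cmp z y}

@[simp]
theorem mem_commonCmp {x y z : S} : z ∈ commonCmp x y ↔ Cmp z x ∧ Cmp z y := by
  simp [commonCmp]

theorem commonCmp_comm (x y : S) : commonCmp x y = commonCmp y x := by
  ext z
  simp [and_comm]

/-- A positive weight on a poset for which, for each `s`, the weight of `s` and the weights of the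
elements comparable to `s` add up to `1`, where the comparability graph has neither a claw nor a
diamond as an induced subgraph. -/
structure IsBalanced (u : S → ℝ) : Prop where
  pos : ∀ s, 0 < u s
  add_sum : ∀ s, u s + ∑ t ∈ commonCmp s s, u t = 1
  no_claw : ∀ {b c d e : S}, Cmp b c → Cmp b d → Cmp b e → ¬Cmp c d → ¬Cmp c e → Cmp d e
  no_diamond : ∀ {a b c d : S}, Cmp a b → a ≠ b → Cmp a c → Cmp a d → Cmp b c → Cmp b d → Cmp c d

/-- The total weight of the elements comparable to both `x` and `y`. -/
noncomputable def cliqueWeight (u : S → ℝ) (x y : S) : ℝ := ∑ z ∈ commonCmp x y, u z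

theorem cliqueWeight_comm (u : S → ℝ) (x y : S) : cliqueWeight u x y = cliqueWeight u y x := by
  rw [cliqueWeight, commonCmp_comm, cliqueWeight]

/-- The elements comparable to `x` form a chain. -/
def IsSimplicial (x : S) : Prop := ∀ c d, Cmp c x → Cmp d x → Cmp c d

theorem mem_commonCmp_left {x y : S} (h : Cmp x y) : x ∈ commonCmp x y :=
  mem_commonCmp.2 ⟨Cmp.refl x, h⟩

theorem IsSimplicial.commonCmp_eq {x y : S} (hx : IsSimplicial x) (hy : Cmp y x) :
    commonCmp x y = commonCmp x x := by
  ext z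
  simp only [mem_commonCmp, and_self, and_iff_left_iff_imp]
  exact fun hz => hx z y hz hy

namespace IsBalanced

variable {u : S → ℝ} (hu : IsBalanced u)
include hu

/-- Without a claw the two cliques cover everything comparable to `x`; without a diamond they share
only `x`. Counting `x` twice is what the diagonal entry 2 does in the equation of `x`. -/
theorem cliqueWeight_add_cliqueWeight {x c d : S} (hc : Cmp c x) (hd : Cmp d x)
    (hcd : ¬Cmp c d) : cliqueWeight u x c + cliqueWeight u x d = 1 := by
  have hunion : commonCmp x c ∪ commonCmp x d = commonCmp x x := by
    ext z
    simp only [Finset.mem_union, mem_commonCmp, and_self]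
    constructor
    · rintro (h | h) <;> exact h.1
    · intro hz
      by_cases hcz : Cmp c z
      · exact Or.inl ⟨hz, hcz.symm⟩
      · exact Or.inr ⟨hz, (hu.no_claw hc.symm hd.symm hz.symm hcd hcz).symm⟩
  have hinter : commonCmp x c ∩ commonCmp x d = {x} := by
    ext z
    simp only [Finset.mem_inter, mem_commonCmp, Finset.mem_singleton]
    constructor
    · rintro ⟨⟨h1, h2⟩, -, h3⟩
      by_contra hne
      exact hcd (hu.no_diamond h1 hne h2 h3 hc.symm hd.symm)
    · rintro rfl
      exact ⟨⟨Cmp.refl z, hc.symm⟩, Cmp.refl z, hd.symm⟩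
  have h := Finset.sum_union_inter (s₁ := commonCmp x c) (s₂ := commonCmp x d) (f := u)
  rw [hunion, hinter, Finset.sum_singleton] at h
  have := hu.add_sum x
  unfold cliqueWeight
  linarith

theorem cliqueWeight_of_isSimplicial {x y : S} (hx : IsSimplicial x) (hy : Cmp y x) :
    cliqueWeight u x y = 1 - u x := by
  rw [cliqueWeight, hx.commonCmp_eq hy]
  linarith [hu.add_sum x]

theorem add_le_cliqueWeight {x y : S} (hne : x ≠ y) (h : Cmp x y) :
    u x + u y ≤ cliqueWeight u x y := by
  rw [← Finset.sum_pair hne]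
  refine Finset.sum_le_sum_of_subset_of_nonneg ?_ fun t _ _ => (hu.pos t).le
  intro z hz
  rw [Finset.mem_insert, Finset.mem_singleton] at hz
  rcases hz with rfl | rfl
  · exact mem_commonCmp_left h
  · rw [commonCmp_comm]
    exact mem_commonCmp_left h.symm

theorem commonCmp_subset {a b a' b' : S} (hab : Cmp a b) (hne : a ≠ b)
    (ha' : a' ∈ commonCmp a b) (hb' : b' ∈ commonCmp a b) :
    commonCmp a b ⊆ commonCmp a' b' := by
  intro z hz
  rw [mem_commonCmp] at ha' hb' hz ⊢
  exact ⟨hu.no_diamond hab hne hz.1.symm ha'.1.symm hz.2.symm ha'.2.symm,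
    hu.no_diamond hab hne hz.1.symm hb'.1.symm hz.2.symm hb'.2.symm⟩

/-- Without diamonds, a clique is determined by any two of its elements. -/
theorem commonCmp_eq {a b a' b' : S} (hab : Cmp a b) (hne : a ≠ b)
    (ha' : a' ∈ commonCmp a b) (hb' : b' ∈ commonCmp a b) (hne' : a' ≠ b') :
    commonCmp a' b' = commonCmp a b := by
  have h1 : Cmp a' b' := by
    rw [mem_commonCmp] at ha' hb'
    exact hu.no_diamond hab hne ha'.1.symm hb'.1.symm ha'.2.symm hb'.2.symm
  refine (hu.commonCmp_subset h1 hne' ?_ ?_).antisymm (hu.commonCmp_subset hab hne ha' hb')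
  · rw [mem_commonCmp] at ha' hb' ⊢
    exact ⟨ha'.1.symm, hb'.1.symm⟩
  · rw [mem_commonCmp] at ha' hb' ⊢
    exact ⟨ha'.2.symm, hb'.2.symm⟩

/-- Two elements above `x` are also above `a`, and the edge from `a` to `x` would complete a diamond
if they were incomparable; dually below. Elements on opposite sides of `x` are comparable through
it. -/
theorem isSimplicial_of_lt_of_lt {a x b : S} (hax : a < x) (hxb : x < b) : IsSimplicial x := by
  rintro c d (hc | hc) (hd | hd)
  · exact hu.no_diamond (Or.inl hxb.le) hxb.ne (Or.inr hc) (Or.inr hd)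
      (Or.inr (hc.trans hxb.le)) (Or.inr (hd.trans hxb.le))
  · exact Or.inl (hc.trans hd)
  · exact Or.inr (hd.trans hc)
  · exact hu.no_diamond (Or.inl hax.le) hax.ne (Or.inl (hax.le.trans hc))
      (Or.inl (hax.le.trans hd)) (Or.inl hc) (Or.inl hd)

end IsBalanced

theorem HasPositiveWeight.isBalanced (hconn : (SimpleGraph.hasse S).Connected)
    (hW : HasPositiveWeight (comparabilityMatrix S ℝ)) : ∃ u : S → ℝ, IsBalanced u := by
  obtain ⟨u, hu, hAu⟩ := hW.2
  refine ⟨u, hu, fun s => ?_, hW.no_claw hconn, hW.no_diamond hconn⟩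
  have h := congrFun hAu s
  rw [comparabilityMatrix_mulVec, Pi.one_apply] at h
  rw [← h]
  congr 2
  ext t
  simp [Cmp]

/-- The comparability matrix of a poset in which each minimal element lies below two maximal ones
and each maximal element lies above two minimal ones is not positive definite. -/
theorem not_posDef_of_two_extremal [Nonempty S]
    (hmin : ∀ x : S, IsMin x → ∃ c d, c ≠ d ∧ IsMax c ∧ IsMax d ∧ x < c ∧ x < d)
    (hmax : ∀ x : S, IsMax x → ∃ c d, c ≠ d ∧ IsMin c ∧ IsMin d ∧ c < x ∧ d < x) :
    ¬(comparabilityMatrix S ℝ).PosDef := by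
  intro hpd
  -- A test vector on which the form is nonpositive: +1 at minimal and -1 at maximal elements. In
  -- the row of a minimal `x`, the diagonal contributes 2 and two maximal elements above contribute
  -- -2, while nothing else is positive; dually for maximal elements.
  set h : S → ℝ := fun x => (if IsMin x then 1 else 0) - (if IsMax x then 1 else 0) with hh
  have hnot : ∀ x, IsMin x → ¬IsMax x := fun x hx hx' => by
    obtain ⟨c, -, -, -, -, hc, -⟩ := hmin x hx
    exact hx'.not_lt hc
  have h1 : ∀ x, IsMin x → h x = 1 := fun x hx => by simp [hh, hx, hnot x hx]
  have h2 : ∀ x, IsMax x → h x = -1 := fun x hx => by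
    have hx' : ¬IsMin x := fun h => hnot x h hx
    simp only [hh, if_pos hx, if_neg hx']
    norm_num
  have h3 : ∀ x, ¬IsMin x → h x ≤ 0 := fun x hx => by
    simp only [hh, hx, if_false]
    split_ifs <;> norm_num
  have h4 : ∀ x, ¬IsMax x → 0 ≤ h x := fun x hx => by
    simp only [hh, hx, if_false]
    split_ifs <;> norm_num
  obtain ⟨x₀, hx₀⟩ : ∃ x : S, IsMin x := by
    obtain ⟨m, hm⟩ := (Set.toFinite (Set.univ : Set S)).exists_minimal Set.univ_nonempty
    exact ⟨m, fun y hy => hm.2 (Set.mem_univ y) hy⟩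
  have hne : h ≠ 0 := fun h0 => by
    have := h1 x₀ hx₀
    simp [h0] at this
  have hpos := hpd.dotProduct_mulVec_pos hne
  rw [star_trivial] at hpos
  refine hpos.not_ge (Finset.sum_nonpos fun x _ => ?_)
  rw [comparabilityMatrix_mulVec]
  by_cases hx : IsMin x
  · obtain ⟨c, d, hcd, hc, hd, hxc, hxd⟩ := hmin x hx
    have hle := sum_le_of_three (F := {t | t ≤ x ∨ x ≤ t}) (f := h) (x := x) (c := c) (d := d)
      (by simp) (by simp [hxc.le]) (by simp [hxd.le]) hxc.ne hxd.ne hcd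
      (fun t ht htx _ _ => h3 t fun htmin => htx (by
        rcases (by simpa using ht : t ≤ x ∨ x ≤ t) with h | h
        · exact le_antisymm h (hx h)
        · exact le_antisymm (htmin h) h))
    rw [h1 x hx, h2 c hc, h2 d hd] at hle
    rw [h1 x hx]
    linarith
  by_cases hx' : IsMax x
  · obtain ⟨c, d, hcd, hc, hd, hxc, hxd⟩ := hmax x hx'
    have hle := sum_le_of_three (F := {t | t ≤ x ∨ x ≤ t}) (f := fun t => -h t) (x := x) (c := c)
      (d := d) (by simp) (by simp [hxc.le]) (by simp [hxd.le]) hxc.ne' hxd.ne' hcd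
      (fun t ht htx _ _ => neg_nonpos.2 (h4 t fun htmax => htx (by
        rcases (by simpa using ht : t ≤ x ∨ x ≤ t) with h | h
        · exact le_antisymm h (htmax h)
        · exact le_antisymm (hx' h) h)))
    rw [h2 x hx', h1 c hc, h1 d hd, Finset.sum_neg_distrib] at hle
    rw [h2 x hx']
    linarith
  · have : h x = 0 := by simp [hh, hx, hx']
    simp [this]

namespace IsBalanced

variable {u : S → ℝ} (hu : IsBalanced u)
include hu

/-- If no element is simplicial, nothing lies strictly between two others, so the incomparable
neighbours of an extremal element are extremal of the opposite kind, and the form would not be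
definite. -/
theorem exists_isSimplicial [Nonempty S] (hpd : (comparabilityMatrix S ℝ).PosDef) :
    ∃ s : S, IsSimplicial s := by
  by_contra! hns
  have hnb : ∀ x : S, ∃ c d, Cmp c x ∧ Cmp d x ∧ ¬Cmp c d := fun x => by
    have := hns x
    unfold IsSimplicial at this
    push Not at this
    exact this
  have hne : ∀ {x c d : S}, Cmp d x → ¬Cmp c d → x ≠ c := by
    rintro x c d hd hcd rfl
    exact hcd hd.symm
  refine not_posDef_of_two_extremal (fun x hx => ?_) (fun x hx => ?_) hpd
  · obtain ⟨c, d, hc, hd, hcd⟩ := hnb x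
    have key : ∀ {y : S}, Cmp y x → x ≠ y → IsMax y ∧ x < y := fun {y} hy hne => by
      have hlt : x < y := (hy.symm.lt_or_gt hne).resolve_right hx.not_lt
      refine ⟨?_, hlt⟩
      by_contra hmax
      obtain ⟨z, hz⟩ := not_isMax_iff.1 hmax
      exact hns y (hu.isSimplicial_of_lt_of_lt hlt hz)
    have hc' := key hc (hne hd hcd)
    have hd' := key hd (hne hc fun h => hcd h.symm)
    exact ⟨c, d, by rintro rfl; exact hcd (Cmp.refl c), hc'.1, hd'.1, hc'.2, hd'.2⟩
  · obtain ⟨c, d, hc, hd, hcd⟩ := hnb x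
    have key : ∀ {y : S}, Cmp y x → x ≠ y → IsMin y ∧ y < x := fun {y} hy hne => by
      have hlt : y < x := (hy.symm.lt_or_gt hne).resolve_left hx.not_lt
      refine ⟨?_, hlt⟩
      by_contra hmin
      obtain ⟨z, hz⟩ := not_isMin_iff.1 hmin
      exact hns y (hu.isSimplicial_of_lt_of_lt hz hlt)
    have hc' := key hc (hne hd hcd)
    have hd' := key hd (hne hc fun h => hcd h.symm)
    exact ⟨c, d, by rintro rfl; exact hcd (Cmp.refl c), hc'.1, hd'.1, hc'.2, hd'.2⟩

omit hu in
theorem _root_.AntimonotonousPosets.exists_ne_cmp (hconn : (SimpleGraph.hasse S).Connected)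
    [Nontrivial S] (x : S) : ∃ y, x ≠ y ∧ Cmp y x := by
  by_contra! h
  have := eq_univ_of_closed_under_cmp hconn (Set.singleton_nonempty x) (by
    rintro s rfl t hst
    by_contra hne
    exact h t (fun h => hne h.symm) hst.symm)
  obtain ⟨y, hy⟩ := exists_ne x
  exact hy (this ▸ Set.mem_univ y : y ∈ ({x} : Set S))

/-- The cliques have one of two weights. -/
theorem exists_cliqueWeight_eq_or [Nontrivial S] (hconn : (SimpleGraph.hasse S).Connected)
    (hpd : (comparabilityMatrix S ℝ).PosDef) :
    ∃ β : ℝ, 1 / 2 < β ∧ ∀ x y, x ≠ y → Cmp x y →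
      cliqueWeight u x y = β ∨ cliqueWeight u x y = 1 - β := by
  obtain ⟨s, hs⟩ := hu.exists_isSimplicial hpd
  -- A simplicial `s` lies in one clique, of weight 1 - u s; this is at least u s + u y for a
  -- neighbour `y`, so it exceeds 1/2.
  refine ⟨1 - u s, ?_, ?_⟩
  · obtain ⟨y, hne, hy⟩ := exists_ne_cmp hconn s
    have h1 := hu.add_le_cliqueWeight hne hy.symm
    rw [hu.cliqueWeight_of_isSimplicial hs hy] at h1
    linarith [hu.pos y]
  -- Moving to another clique through a common element replaces the weight w by 1 - w, so the two
  -- values propagate through the connected poset.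
  · have key := eq_univ_of_closed_under_cmp hconn (T := {x | ∀ y, x ≠ y → Cmp x y →
      cliqueWeight u x y = 1 - u s ∨ cliqueWeight u x y = 1 - (1 - u s)})
      ⟨s, fun y _ hy => Or.inl (hu.cliqueWeight_of_isSimplicial hs hy.symm)⟩ (by
        intro x hx x' hxx' z hne hz
        by_cases hxe : x = x'
        · subst hxe
          exact hx z hne hz
        have hxx := hx x' hxe hxx'
        by_cases hzx : Cmp z x
        · by_cases hzx' : z = x
          · subst hzx'
            rwa [cliqueWeight_comm]
          · have : commonCmp x' z = commonCmp x x' := by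
              refine hu.commonCmp_eq hxx' hxe ?_ ?_ hne
              · exact mem_commonCmp.2 ⟨hxx'.symm, Cmp.refl _⟩
              · exact mem_commonCmp.2 ⟨hzx, hz.symm⟩
            rw [cliqueWeight, this]
            exact hxx
        · have := hu.cliqueWeight_add_cliqueWeight hz.symm hxx' hzx
          rw [cliqueWeight_comm u x' x] at this
          rcases hxx with h | h
          · right
            linarith
          · left
            linarith)
    intro x
    have hx : x ∈ (Set.univ : Set S) := Set.mem_univ x
    rw [← key] at hx
    exact hx

end IsBalanced

end WeightedPosets

/-! ### Decomposition into heavy chains joined by links -/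

section HeavyChains

open scoped Classical

variable {S : Type*} [Fintype S] [PartialOrder S]

/-- A balanced poset with at least two elements in which the cliques have weight `β > 1 / 2` or
`1 - β`. -/
structure IsSplit (u : S → ℝ) (β : ℝ) : Prop extends IsBalanced u where
  half_lt : 1 / 2 < β
  exists_cmp : ∀ x : S, ∃ y, x ≠ y ∧ Cmp y x
  weight_eq_or : ∀ x y, x ≠ y → Cmp x y → cliqueWeight u x y = β ∨ cliqueWeight u x y = 1 - β

/-- `x` and `y` are equal or belong to a clique of weight `β`. -/
def Heavy (u : S → ℝ) (β : ℝ) (x y : S) : Prop := x = y ∨ Cmp x y ∧ cliqueWeight u x y = β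

/-- `x < y`, and these elements belong to a clique of weight `1 - β`. -/
def Link (u : S → ℝ) (β : ℝ) (x y : S) : Prop := x < y ∧ cliqueWeight u x y = 1 - β

theorem Heavy.cmp {u : S → ℝ} {β : ℝ} {x y : S} (h : Heavy u β x y) : Cmp x y := by
  rcases h with rfl | h
  · exact Cmp.refl x
  · exact h.1

theorem Heavy.symm {u : S → ℝ} {β : ℝ} {x y : S} (h : Heavy u β x y) : Heavy u β y x := by
  rcases h with rfl | h
  · exact Or.inl rfl
  · exact Or.inr ⟨h.1.symm, cliqueWeight_comm u y x ▸ h.2⟩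

namespace IsSplit

variable {u : S → ℝ} {β : ℝ} (hu : IsSplit u β)
include hu

/-- Two different heavy cliques through `y` would have total weight 2β > 1. -/
theorem heavy_trans {x y z : S} (hxy : Heavy u β x y) (hyz : Heavy u β y z) : Heavy u β x z := by
  by_cases h1 : x = y
  · rwa [h1]
  by_cases h2 : y = z
  · rwa [← h2]
  by_cases h3 : x = z
  · exact Or.inl h3
  have hxy' := hxy.resolve_left h1
  have hyz' := hyz.resolve_left h2
  have hβ := hu.half_lt
  by_cases hxz : Cmp x z
  · refine Or.inr ⟨hxz, ?_⟩
    rw [← hxy'.2, cliqueWeight, hu.commonCmp_eq hxy'.1 h1 (mem_commonCmp_left hxy'.1)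
      (mem_commonCmp.2 ⟨hxz.symm, hyz'.1.symm⟩) h3, cliqueWeight]
  · have := hu.cliqueWeight_add_cliqueWeight hxy'.1 hyz'.1.symm hxz
    rw [cliqueWeight_comm u y x, hxy'.2, hyz'.2] at this
    linarith

theorem heavy_or_link {x y : S} (h : x < y) : Heavy u β x y ∨ Link u β x y :=
  (hu.weight_eq_or x y h.ne (Or.inl h.le)).imp (fun h' => Or.inr ⟨Or.inl h.le, h'⟩) fun h' => ⟨h, h'⟩

omit hu in
theorem not_heavy_of_link (hβ : 1 / 2 < β) {x y : S} (h : Link u β x y) : ¬Heavy u β x y := by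
  rintro (h' | h')
  · exact h.1.ne h'
  · have := h.2
    rw [h'.2] at this
    linarith

theorem not_heavy {x y : S} (h : Link u β x y) : ¬Heavy u β x y := not_heavy_of_link hu.half_lt h

/-- Weight 1 - β would force u x = β > 1/2, but u x + u y ≤ 1 - u x forces u x < 1/2. -/
theorem cliqueWeight_eq_of_isSimplicial {x y : S} (hx : IsSimplicial x) (hne : x ≠ y)
    (hy : Cmp y x) : cliqueWeight u x y = β := by
  refine (hu.weight_eq_or x y hne hy.symm).resolve_right fun h => ?_
  have h1 := hu.cliqueWeight_of_isSimplicial hx hy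
  have h2 := hu.add_le_cliqueWeight hne hy.symm
  have := hu.pos y
  have := hu.half_lt
  linarith

/-- Otherwise `p` lies strictly between two elements, so it is simplicial and its cliques are heavy.
-/
theorem isMin_of_link {p m : S} (h : Link u β p m) : IsMin p := by
  by_contra hp
  obtain ⟨a, ha⟩ := not_isMin_iff.1 hp
  have h1 := hu.cliqueWeight_eq_of_isSimplicial (hu.isSimplicial_of_lt_of_lt ha h.1) h.1.ne
    (Or.inr h.1.le)
  have := hu.half_lt
  have := h.2
  linarith

theorem isMax_of_link {p m : S} (h : Link u β p m) : IsMax m := by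
  by_contra hp
  obtain ⟨a, ha⟩ := not_isMax_iff.1 hp
  have h1 := hu.cliqueWeight_eq_of_isSimplicial (hu.isSimplicial_of_lt_of_lt h.1 ha) h.1.ne'
    (Or.inl h.1.le)
  rw [cliqueWeight_comm] at h1
  have := hu.half_lt
  have := h.2
  linarith

/-- A third element of a light clique would lie strictly between the other two, so it would be
simplicial and the clique heavy. -/
theorem eq_or_eq_of_link {p m z : S} (h : Link u β p m) (hzp : Cmp z p) (hzm : Cmp z m) :
    z = p ∨ z = m := by
  by_contra! hne
  have hpz : p < z := (hzp.symm.lt_or_gt hne.1.symm).resolve_right (hu.isMin_of_link h).not_lt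
  have hzm' : z < m := (hzm.lt_or_gt hne.2).resolve_right (hu.isMax_of_link h).not_lt
  have h1 := hu.cliqueWeight_eq_of_isSimplicial (hu.isSimplicial_of_lt_of_lt hpz hzm') hne.1
    hzp.symm
  have h2 : commonCmp z p = commonCmp p m :=
    hu.commonCmp_eq (Or.inl h.1.le) h.1.ne (mem_commonCmp.2 ⟨hzp, hzm⟩)
      (mem_commonCmp_left (Or.inl h.1.le)) hne.1
  rw [cliqueWeight, h2] at h1
  have h3 := h.2
  rw [cliqueWeight, h1] at h3
  have := hu.half_lt
  linarith

/-- Two different light cliques through `p` would have total weight 2 - 2β < 1. -/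
theorem link_right_unique {p m m' : S} (h : Link u β p m) (h' : Link u β p m') : m = m' := by
  by_cases hc : Cmp m' m
  · exact ((hu.eq_or_eq_of_link h (Or.inr h'.1.le) hc).resolve_left h'.1.ne').symm
  · have := hu.cliqueWeight_add_cliqueWeight (Or.inr h'.1.le) (Or.inr h.1.le) hc
    have := hu.half_lt
    have := h.2
    have := h'.2
    linarith

theorem link_left_unique {p p' m : S} (h : Link u β p m) (h' : Link u β p' m) : p = p' := by
  by_cases hc : Cmp p' p
  · exact ((hu.eq_or_eq_of_link h hc (Or.inl h'.1.le)).resolve_right h'.1.ne).symm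
  · have := hu.cliqueWeight_add_cliqueWeight (x := m) (Or.inl h'.1.le) (Or.inl h.1.le) hc
    rw [cliqueWeight_comm u m, cliqueWeight_comm u m, h.2, h'.2] at this
    have := hu.half_lt
    linarith

/-- An element of a light clique is not simplicial, so it has two cliques with weights adding up to
1, and one of them is heavy. -/
theorem exists_ne_heavy (x : S) : ∃ y, x ≠ y ∧ Heavy u β x y := by
  obtain ⟨y, hne, hy⟩ := hu.exists_cmp x
  rcases hu.weight_eq_or x y hne hy.symm with h | h
  · exact ⟨y, hne, Or.inr ⟨hy.symm, h⟩⟩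
  · have hns : ¬IsSimplicial x := fun hs => by
      rw [hu.cliqueWeight_eq_of_isSimplicial hs hne hy] at h
      linarith [hu.half_lt]
    unfold IsSimplicial at hns
    push Not at hns
    obtain ⟨c, d, hc, hd, hcd⟩ := hns
    have hxc : x ≠ c := by rintro rfl; exact hcd hd.symm
    have hxd : x ≠ d := by rintro rfl; exact hcd hc
    have h1 := hu.cliqueWeight_add_cliqueWeight hc hd hcd
    rcases hu.weight_eq_or x c hxc hc.symm with h2 | h2
    · exact ⟨c, hxc, Or.inr ⟨hc.symm, h2⟩⟩
    · exact ⟨d, hxd, Or.inr ⟨hd.symm, by linarith⟩⟩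

theorem exists_isMax_heavy (x : S) : ∃ m, IsMax m ∧ Heavy u β x m := by
  obtain ⟨m, hm⟩ := (Set.toFinite {y | Heavy u β x y}).exists_maximal ⟨x, Or.inl rfl⟩
  have hxm : Heavy u β x m := hm.1
  refine ⟨m, ?_, hxm⟩
  by_contra hmax
  obtain ⟨y, hy⟩ := not_isMax_iff.1 hmax
  rcases hu.heavy_or_link hy with h | h
  · exact (hm.2 (hu.heavy_trans hxm h : y ∈ {y | Heavy u β x y}) hy.le).not_gt hy
  -- A link upwards would make `m` minimal in `S`, so its heavy neighbour `z` would be above it,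
  -- against its maximality in the class.
  · obtain ⟨z, hne, hz⟩ := hu.exists_ne_heavy m
    have hmz : m < z := (hz.cmp.lt_or_gt hne).resolve_right (hu.isMin_of_link h).not_lt
    exact (hm.2 (hu.heavy_trans hxm hz : z ∈ {y | Heavy u β x y}) hmz.le).not_gt hmz

theorem exists_isMin_heavy (x : S) : ∃ m, IsMin m ∧ Heavy u β x m := by
  obtain ⟨m, hm⟩ := (Set.toFinite {y | Heavy u β x y}).exists_minimal ⟨x, Or.inl rfl⟩
  have hxm : Heavy u β x m := hm.1
  refine ⟨m, ?_, hxm⟩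
  by_contra hmin
  obtain ⟨y, hy⟩ := not_isMin_iff.1 hmin
  rcases hu.heavy_or_link hy with h | h
  · exact (hm.2 (hu.heavy_trans hxm h.symm : y ∈ {y | Heavy u β x y}) hy.le).not_gt hy
  · obtain ⟨z, hne, hz⟩ := hu.exists_ne_heavy m
    have hmz : z < m := (hz.cmp.lt_or_gt hne).resolve_left (hu.isMax_of_link h).not_lt
    exact (hm.2 (hu.heavy_trans hxm hz : z ∈ {y | Heavy u β x y}) hmz.le).not_gt hmz

omit hu in
theorem eq_of_isMax_of_heavy {m m' : S} (hm : IsMax m) (hm' : IsMax m') (h : Heavy u β m m') :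
    m = m' := by
  rcases h.cmp with h | h
  · exact hm.eq_of_le h
  · exact (hm'.eq_of_le h).symm

omit hu in
theorem eq_of_isMin_of_heavy {m m' : S} (hm : IsMin m) (hm' : IsMin m') (h : Heavy u β m m') :
    m = m' := by
  rcases h.cmp with h | h
  · exact (hm'.eq_of_le h)
  · exact (hm.eq_of_le h).symm

theorem lt_of_isMin_of_isMax {p m : S} (hp : IsMin p) (hm : IsMax m) (h : Heavy u β p m) :
    p < m := by
  have hne : p ≠ m := by
    rintro rfl
    obtain ⟨z, hne, hz⟩ := hu.exists_ne_heavy p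
    rcases hz.cmp with h | h
    · exact hne (hm.eq_of_le h)
    · exact hne (hp.eq_of_le h).symm
  exact (h.cmp.lt_or_gt hne).resolve_right hp.not_lt

/-- A split poset that is not a chain is a wattle. -/
theorem exists_isWattle (hconn : (SimpleGraph.hasse S).Connected)
    (hpd : (comparabilityMatrix S ℝ).PosDef)
    (hchain : ¬IsChain (· ≤ ·) (Set.univ : Set S)) :
    ∃ (t : ℕ) (Z : Fin t → Finset S), IsWattle Z := by
  have hnonempty : Nonempty S := hconn.nonempty
  -- Each heavy class is named by the only maximal element of `S` that it contains; `R` sends a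
  -- class to the one whose greatest element is linked to its least element.
  let V := {m : S // IsMax m}
  let R : V → V → Prop := fun m m' => ∃ p, IsMin p ∧ Heavy u β m.1 p ∧ Link u β p m'.1
  have hV : Nonempty V := by
    obtain ⟨m, hm, -⟩ := hu.exists_isMax_heavy (Classical.arbitrary S)
    exact ⟨⟨m, hm⟩⟩
  have hfun : ∀ x y z, R x y → R x z → y = z := by
    rintro x y z ⟨p, hp, hxp, hpy⟩ ⟨q, hq, hxq, hqz⟩
    have := eq_of_isMin_of_heavy hp hq (hu.heavy_trans hxp.symm hxq)
    subst this
    exact Subtype.ext (hu.link_right_unique hpy hqz)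
  have hinj : ∀ x y z, R x z → R y z → x = y := by
    rintro x y z ⟨p, hp, hxp, hpz⟩ ⟨q, hq, hyq, hqz⟩
    have := hu.link_left_unique hpz hqz
    subst this
    exact Subtype.ext (eq_of_isMax_of_heavy x.2 y.2 (hu.heavy_trans hxp hyq.symm))
  -- If every class had a predecessor and a successor, each extremal element would have two opposite
  -- extremal neighbours, one in its class and one through a link.
  have hend : ∃ v, (∀ x, ¬R x v) ∨ ∀ x, ¬R v x := by
    by_contra! hall
    refine not_posDef_of_two_extremal (fun x hx => ?_) (fun x hx => ?_) hpd
    · obtain ⟨m, hm, hxm⟩ := hu.exists_isMax_heavy x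
      obtain ⟨m', p, hp, hmp, hpm'⟩ := (hall ⟨m, hm⟩).2
      have := eq_of_isMin_of_heavy hx hp (hu.heavy_trans hxm hmp)
      subst this
      refine ⟨m, m', ?_, hm, m'.2, hu.lt_of_isMin_of_isMax hx hm hxm, hpm'.1⟩
      rintro rfl
      exact hu.not_heavy hpm' hxm
    · obtain ⟨p, hp, hxp⟩ := hu.exists_isMin_heavy x
      obtain ⟨m, q, hq, -, hqx⟩ := (hall ⟨x, hx⟩).1
      refine ⟨p, q, ?_, hp, hq, hu.lt_of_isMin_of_isMax hp hx hxp.symm, hqx.1⟩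
      rintro rfl
      exact hu.not_heavy hqx hxp.symm
  have hconnR : ∀ T : Set V, T.Nonempty → (∀ x y, R x y → (x ∈ T ↔ y ∈ T)) → T = Set.univ := by
    rintro T ⟨m₀, hm₀⟩ hT
    have hlink : ∀ {p q : S}, Link u β p q → ∀ m m' : V, Heavy u β m.1 p → Heavy u β m'.1 q →
        (m ∈ T ↔ m' ∈ T) := by
      intro p q hpq m m' hmp hmq
      have h1 : m'.1 = q := eq_of_isMax_of_heavy m'.2 (hu.isMax_of_link hpq) hmq
      exact hT m m' ⟨p, hu.isMin_of_link hpq, hmp, h1 ▸ hpq⟩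
    have huniv := eq_univ_of_closed_under_cmp hconn (T := {x | ∃ m ∈ T, Heavy u β m.1 x})
      ⟨m₀.1, m₀, hm₀, Or.inl rfl⟩ (by
        rintro x ⟨m, hm, hmx⟩ y hxy
        obtain ⟨m', hm', hym'⟩ := hu.exists_isMax_heavy y
        by_cases hne : x = y
        · exact ⟨m, hm, hne ▸ hmx⟩
        rcases hxy.lt_or_gt hne with hlt | hlt
        · rcases hu.heavy_or_link hlt with h | h
          · exact ⟨m, hm, hu.heavy_trans hmx h⟩
          · exact ⟨⟨m', hm'⟩, (hlink h m ⟨m', hm'⟩ hmx hym'.symm).1 hm, hym'.symm⟩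
        · rcases hu.heavy_or_link hlt with h | h
          · exact ⟨m, hm, hu.heavy_trans hmx h.symm⟩
          · exact ⟨⟨m', hm'⟩, (hlink h ⟨m', hm'⟩ m hym'.symm hmx).2 hm, hym'.symm⟩)
    refine Set.eq_univ_of_forall fun m => ?_
    obtain ⟨m', hm', h⟩ : m.1 ∈ {x | ∃ m ∈ T, Heavy u β m.1 x} := huniv ▸ Set.mem_univ _
    have : m' = m := Subtype.ext (eq_of_isMax_of_heavy m'.2 m.2 h)
    exact this ▸ hm'
  obtain ⟨t, e, he⟩ := exists_enumeration R hfun hinj hend hconnR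
  have hmem : ∀ (i : Fin t) (x : S), x ∈ (Finset.univ.filter fun x => Heavy u β (e i).1 x) ↔
      Heavy u β (e i).1 x := fun i x => by simp
  have hsame : ∀ {i j : Fin t} {x : S}, Heavy u β (e i).1 x → Heavy u β (e j).1 x → i = j := by
    intro i j x hi hj
    exact e.injective (Subtype.ext (eq_of_isMax_of_heavy (e i).2 (e j).2
      (hu.heavy_trans hi hj.symm)))
  have hcov : ∀ x, ∃ i, Heavy u β (e i).1 x := fun x => by
    obtain ⟨m, hm, hxm⟩ := hu.exists_isMax_heavy x
    refine ⟨e.symm ⟨m, hm⟩, ?_⟩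
    rw [e.apply_symm_apply]
    exact hxm.symm
  refine ⟨t, fun i => {x | Heavy u β (e i).1 x}, ?_, ?_, ?_, ?_, ?_, ?_⟩
  · by_contra! ht
    refine hchain fun x _ y _ _ => ?_
    obtain ⟨i, hi⟩ := hcov x
    obtain ⟨j, hj⟩ := hcov y
    have : i = j := Fin.ext (by omega)
    subst this
    exact (hu.heavy_trans hi.symm hj).cmp
  · intro i
    obtain ⟨z, hne, hz⟩ := hu.exists_ne_heavy (e i).1
    rw [← Finset.card_pair hne]
    refine Finset.card_le_card fun y hy => ?_
    rw [hmem]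
    rw [Finset.mem_insert, Finset.mem_singleton] at hy
    rcases hy with rfl | rfl
    · exact Or.inl rfl
    · exact hz
  · intro i j hij
    rw [Finset.disjoint_left]
    intro x hi hj
    rw [hmem] at hi hj
    exact hij (hsame hi hj)
  · intro x
    obtain ⟨i, hi⟩ := hcov x
    exact ⟨i, (hmem i x).2 hi⟩
  · intro i x hx y hy _
    exact (hu.heavy_trans ((hmem i x).1 hx).symm ((hmem i y).1 hy)).cmp
  · intro i j hij a ha b hb
    rw [hmem] at ha hb
    constructor
    · intro hab
      have hlink : Link u β a b := (hu.heavy_or_link hab).resolve_left fun h =>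
        hij (hsame (hu.heavy_trans ha h) hb)
      have hamin := hu.isMin_of_link hlink
      have hbmax := hu.isMax_of_link hlink
      have hbj : (e j).1 = b := eq_of_isMax_of_heavy (e j).2 hbmax hb
      refine ⟨(he i j).1 ⟨a, hamin, ha, hbj ▸ hlink⟩, ⟨by simpa using ha, fun x hx => ?_⟩,
        ⟨by simpa using hb, fun x hx => ?_⟩⟩
      · rcases (hu.heavy_trans ha.symm ((hmem i x).1 hx)).cmp with h | h
        · exact h
        · exact (hamin.eq_of_le h).ge
      · rcases (hu.heavy_trans hb.symm ((hmem j x).1 hx)).cmp with h | h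
        · exact (hbmax.eq_of_le h).ge
        · exact h
    · rintro ⟨hij', hla, hgb⟩
      obtain ⟨p, hp, hip, hpj⟩ := (he i j).2 hij'
      have h1 : p = a := (hp.eq_of_le (hla.2 ((hmem i p).2 hip))).symm
      have h2 : (e j).1 = b := (e j).2.eq_of_le (hgb.2 ((hmem j _).2 (Or.inl rfl)))
      rw [← h1, ← h2]
      exact hpj.1

end IsSplit

theorem HasPositiveWeight.exists_isWattle (hconn : (SimpleGraph.hasse S).Connected)
    (hW : HasPositiveWeight (comparabilityMatrix S ℝ))
    (hchain : ¬IsChain (· ≤ ·) (Set.univ : Set S)) :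
    ∃ (t : ℕ) (Z : Fin t → Finset S), IsWattle Z := by
  have : Nontrivial S := by
    by_contra h
    rw [not_nontrivial_iff_subsingleton] at h
    exact hchain (Set.subsingleton_univ.isChain)
  obtain ⟨u, hu⟩ := hW.isBalanced hconn
  obtain ⟨β, hβ, hor⟩ := hu.exists_cliqueWeight_eq_or hconn hW.1
  exact IsSplit.exists_isWattle ⟨hu, hβ, exists_ne_cmp hconn, hor⟩ hconn hW.1 hchain

end HeavyChains

/-! ### The form of a wattle and the equations for its weights -/

section Wattles

open scoped Classical

/-- The extension of a finite sequence by zeros. -/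
def extend {t : ℕ} (g : Fin t → ℝ) (n : ℕ) : ℝ := if h : n < t then g ⟨n, h⟩ else 0

/-- The extension of a finite sequence by zeros, shifted by one place. -/
def extendShift {t : ℕ} (g : Fin t → ℝ) : ℕ → ℝ
  | 0 => 0
  | n + 1 => extend g n

@[simp]
theorem extend_val {t : ℕ} (g : Fin t → ℝ) (k : Fin t) : extend g k = g k := by simp [extend]

theorem extend_of_le {t : ℕ} (g : Fin t → ℝ) {n : ℕ} (h : t ≤ n) : extend g n = 0 := by
  simp [extend, h]

theorem extend_of_lt {t : ℕ} (g : Fin t → ℝ) {n : ℕ} (h : n < t) : extend g n = g ⟨n, h⟩ := by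
  simp [extend, h]

theorem sum_ite_eq_extend {t : ℕ} (g : Fin t → ℝ) (n : ℕ) :
    ∑ j : Fin t, (if n = j then g j else 0) = extend g n := by
  by_cases h : n < t
  · rw [extend_of_lt g h, Finset.sum_eq_single ⟨n, h⟩]
    · simp
    · intro j _ hj
      rw [if_neg]
      rintro rfl
      exact hj rfl
    · simp
  · rw [extend_of_le g (not_lt.1 h)]
    refine Finset.sum_eq_zero fun j _ => if_neg ?_
    rintro rfl
    exact h j.2

theorem sum_ite_eq_extendShift {t : ℕ} (g : Fin t → ℝ) (n : ℕ) :
    ∑ j : Fin t, (if (j : ℕ) + 1 = n then g j else 0) = extendShift g n := by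
  cases n with
  | zero => simp [extendShift]
  | succ n =>
    rw [extendShift, ← sum_ite_eq_extend]
    simp [eq_comm]

theorem sum_range_shift {t : ℕ} (g : ℕ → ℝ) (ht : g t = 0) :
    ∑ k ∈ Finset.range t, g (k + 1) + g 0 = ∑ k ∈ Finset.range t, g k := by
  rw [← Finset.sum_range_succ', Finset.sum_range_succ, ht, add_zero]

variable {S : Type*} [PartialOrder S] {t : ℕ} {Z : Fin t → Finset S}

namespace IsWattle

variable (hZ : IsWattle Z)
include hZ

theorem nonempty (k : Fin t) : (Z k).Nonempty := by
  have := hZ.two_le_card k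
  exact Finset.card_pos.1 (by omega)

theorem exists_isLeast (k : Fin t) : ∃ s, IsLeast (Z k : Set S) s := by
  obtain ⟨m, hm⟩ := (Z k).finite_toSet.exists_minimal (hZ.nonempty k)
  exact ⟨m, hm.1, fun y hy => ((hZ.isChain k).total hm.1 hy).elim id fun h => hm.2 hy h⟩

theorem exists_isGreatest (k : Fin t) : ∃ s, IsGreatest (Z k : Set S) s := by
  obtain ⟨m, hm⟩ := (Z k).finite_toSet.exists_maximal (hZ.nonempty k)
  exact ⟨m, hm.1, fun y hy => ((hZ.isChain k).total hm.1 hy).elim (fun h => hm.2 hy h) id⟩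

/-- The least element of the `k`-th chain. -/
noncomputable def bot (k : Fin t) : S := (hZ.exists_isLeast k).choose

/-- The greatest element of the `k`-th chain. -/
noncomputable def top (k : Fin t) : S := (hZ.exists_isGreatest k).choose

theorem isLeast_bot (k : Fin t) : IsLeast (Z k : Set S) (hZ.bot k) :=
  (hZ.exists_isLeast k).choose_spec

theorem isGreatest_top (k : Fin t) : IsGreatest (Z k : Set S) (hZ.top k) :=
  (hZ.exists_isGreatest k).choose_spec

theorem bot_mem (k : Fin t) : hZ.bot k ∈ Z k := (hZ.isLeast_bot k).1

theorem top_mem (k : Fin t) : hZ.top k ∈ Z k := (hZ.isGreatest_top k).1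

theorem bot_ne_top (k : Fin t) : hZ.bot k ≠ hZ.top k := by
  intro h
  obtain ⟨a, ha, b, hb, hab⟩ := Finset.one_lt_card.1 (hZ.two_le_card k)
  have key : ∀ x ∈ Z k, x = hZ.bot k := fun x hx =>
    le_antisymm (h ▸ (hZ.isGreatest_top k).2 hx) ((hZ.isLeast_bot k).2 hx)
  exact hab ((key a ha).trans (key b hb).symm)

theorem eq_of_mem {i j : Fin t} {s : S} (hi : s ∈ Z i) (hj : s ∈ Z j) : i = j := by
  by_contra h
  exact Finset.disjoint_left.1 (hZ.disjoint i j h) hi hj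

theorem sum_chain (k : Fin t) (f : S → ℝ) : ∑ s ∈ Z k, f s =
    f (hZ.bot k) + f (hZ.top k) + ∑ s ∈ ((Z k).erase (hZ.bot k)).erase (hZ.top k), f s := by
  rw [← Finset.add_sum_erase _ f (hZ.bot_mem k), ← Finset.add_sum_erase _ f
    (Finset.mem_erase.2 ⟨(hZ.bot_ne_top k).symm, hZ.top_mem k⟩), add_assoc]

theorem sum_univ [Fintype S] (f : S → ℝ) : ∑ s, f s = ∑ k, ∑ s ∈ Z k, f s := by
  rw [← Finset.sum_biUnion fun i _ j _ hij => hZ.disjoint i j hij]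
  congr 1
  ext s
  simpa using hZ.cover s

theorem cmp_iff {i k : Fin t} {a s : S} (ha : a ∈ Z i) (hs : s ∈ Z k) : Cmp a s ↔
    i = k ∨ ((k : ℕ) + 1 = i ∧ s = hZ.bot k ∧ a = hZ.top i) ∨
      ((i : ℕ) + 1 = k ∧ s = hZ.top k ∧ a = hZ.bot i) := by
  by_cases hik : i = k
  · subst hik
    have h : Cmp a s := (hZ.isChain i).total ha hs
    simpa using h
  have hne : a ≠ s := fun h => hik (hZ.eq_of_mem ha (h ▸ hs))
  have hcmp : Cmp a s ↔ a < s ∨ s < a := ⟨fun h => h.lt_or_gt hne, Or.imp le_of_lt le_of_lt⟩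
  have hleast : ∀ {j : Fin t} {b : S}, IsLeast (Z j : Set S) b ↔ b = hZ.bot j := fun {j b} =>
    ⟨fun h => h.unique (hZ.isLeast_bot j), fun h => h ▸ hZ.isLeast_bot j⟩
  have hgreat : ∀ {j : Fin t} {b : S}, IsGreatest (Z j : Set S) b ↔ b = hZ.top j := fun {j b} =>
    ⟨fun h => h.unique (hZ.isGreatest_top j), fun h => h ▸ hZ.isGreatest_top j⟩
  rw [hcmp, hZ.lt_iff i k hik a ha s hs, hZ.lt_iff k i (Ne.symm hik) s hs a ha, hleast, hleast,
    hgreat, hgreat]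
  tauto

/-- The comparability matrix of a wattle. -/
theorem comparabilityMatrix_mulVec_apply [Fintype S] (x : S → ℝ) {k : Fin t} {s : S}
    (hs : s ∈ Z k) : (comparabilityMatrix S ℝ *ᵥ x) s = x s + (∑ a ∈ Z k, x a +
      (if s = hZ.bot k then extend (fun j => x (hZ.top j)) (k + 1) else 0) +
      if s = hZ.top k then extendShift (fun j => x (hZ.bot j)) k else 0) := by
  rw [comparabilityMatrix_mulVec, Finset.sum_filter, hZ.sum_univ]
  congr 1
  have key : ∀ i, ∑ a ∈ Z i, (if a ≤ s ∨ s ≤ a then x a else 0) =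
      (if k = i then ∑ a ∈ Z k, x a else 0) +
      (if s = hZ.bot k then (if (k : ℕ) + 1 = i then x (hZ.top i) else 0) else 0) +
      (if s = hZ.top k then (if (i : ℕ) + 1 = k then x (hZ.bot i) else 0) else 0) := by
    intro i
    have h1 : ∀ a ∈ Z i, (if a ≤ s ∨ s ≤ a then x a else 0) = (if k = i then x a else 0) +
        (if a = hZ.top i then (if (k : ℕ) + 1 = i ∧ s = hZ.bot k then x a else 0) else 0) +
        (if a = hZ.bot i then (if (i : ℕ) + 1 = k ∧ s = hZ.top k then x a else 0) else 0) := by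
      intro a ha
      have hc := hZ.cmp_iff ha hs
      unfold Cmp at hc
      simp only [hc]
      by_cases e1 : k = i
      · subst e1
        simp
      · have e1' : ¬i = k := Ne.symm e1
        by_cases e2 : (k : ℕ) + 1 = i
        · have e3 : ¬(i : ℕ) + 1 = k := by omega
          by_cases e4 : s = hZ.bot k <;> by_cases e5 : a = hZ.top i <;> simp [e1, e1', e2, e3, e4, e5]
        · by_cases e3 : (i : ℕ) + 1 = k
          · by_cases e4 : s = hZ.top k <;> by_cases e5 : a = hZ.bot i <;>
              simp [e1, e1', e2, e3, e4, e5]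
          · simp [e1, e1', e2, e3]
    rw [Finset.sum_congr rfl h1, Finset.sum_add_distrib, Finset.sum_add_distrib,
      Finset.sum_ite_eq' (Z i) (hZ.top i), Finset.sum_ite_eq' (Z i) (hZ.bot i),
      if_pos (hZ.top_mem i), if_pos (hZ.bot_mem i)]
    congr 1
    · congr 1
      · split_ifs with h
        · rw [h]
        · simp
      · split_ifs <;> simp_all
    · split_ifs <;> simp_all
  simp only [key, Finset.sum_add_distrib, Finset.sum_ite_eq, Finset.mem_univ, if_true]
  congr 1
  · congr 1
    split_ifs
    · exact sum_ite_eq_extend _ _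
    · simp
  · split_ifs
    · exact sum_ite_eq_extendShift _ _
    · simp

/-- Completing squares: the square of each top coordinate joins that of the bottom coordinate of the
preceding chain, to which it is linked. The first top has no such partner and its square stands
alone; beyond the last chain `extend` supplies 0. -/
theorem dotProduct_mulVec_eq [Fintype S] (x : S → ℝ) :
    x ⬝ᵥ comparabilityMatrix S ℝ *ᵥ x = extend (fun j => x (hZ.top j)) 0 ^ 2 +
      ∑ k : Fin t, ((∑ s ∈ Z k, x s) ^ 2 +
        (x (hZ.bot k) + extend (fun j => x (hZ.top j)) (k + 1)) ^ 2 +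
        ∑ s ∈ ((Z k).erase (hZ.bot k)).erase (hZ.top k), x s ^ 2) := by
  set p : Fin t → ℝ := fun j => x (hZ.bot j) with hp
  set q : Fin t → ℝ := fun j => x (hZ.top j) with hq
  have h1 : ∀ k, ∑ s ∈ Z k, x s * (comparabilityMatrix S ℝ *ᵥ x) s =
      (∑ s ∈ Z k, x s) ^ 2 + ∑ s ∈ ((Z k).erase (hZ.bot k)).erase (hZ.top k), x s ^ 2 +
      (extend p k ^ 2 + extend q k ^ 2 + extend p k * extend q (k + 1) +
        extend q k * extendShift p k) := by
    intro k
    have h2 : ∀ s ∈ Z k, x s * (comparabilityMatrix S ℝ *ᵥ x) s = x s ^ 2 +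
        x s * (∑ a ∈ Z k, x a) + (if s = hZ.bot k then x s * extend q (k + 1) else 0) +
        (if s = hZ.top k then x s * extendShift p k else 0) := by
      intro s hs
      rw [hZ.comparabilityMatrix_mulVec_apply x hs]
      split_ifs <;> ring
    rw [Finset.sum_congr rfl h2, Finset.sum_add_distrib, Finset.sum_add_distrib,
      Finset.sum_add_distrib, Finset.sum_ite_eq' (Z k) (hZ.bot k),
      Finset.sum_ite_eq' (Z k) (hZ.top k), if_pos (hZ.bot_mem k), if_pos (hZ.top_mem k),
      ← Finset.sum_mul, hZ.sum_chain k fun s => x s ^ 2]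
    simp only [extend_val, hp, hq]
    ring
  have h3 := sum_range_shift (t := t) (fun k => extend q k ^ 2) (by simp [extend_of_le])
  have h4 : ∑ k ∈ Finset.range t, extend q (k + 1) * extend p k + extend q 0 * 0 =
      ∑ k ∈ Finset.range t, extend q k * extendShift p k :=
    sum_range_shift (t := t) (fun k => extend q k * extendShift p k) (by simp [extend_of_le])
  rw [mul_zero, add_zero] at h4
  simp only [← Fin.sum_univ_eq_sum_range (fun k => extend q (k + 1) ^ 2),
    ← Fin.sum_univ_eq_sum_range (fun k => extend q k ^ 2)] at h3
  rw [← Fin.sum_univ_eq_sum_range (fun k => extend q (k + 1) * extend p k),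
    ← Fin.sum_univ_eq_sum_range (fun k => extend q k * extendShift p k)] at h4
  have h5 : ∀ k : Fin t, (x (hZ.bot k) + extend q (k + 1)) ^ 2 =
      extend p k ^ 2 + extend q (k + 1) ^ 2 + 2 * (extend q (k + 1) * extend p k) := fun k => by
    rw [extend_val]
    ring
  rw [dotProduct, hZ.sum_univ]
  simp only [h1, h5, Finset.sum_add_distrib, ← Finset.mul_sum, ← h4, ← h3]
  have h6 : ∑ k : Fin t, extend p k * extend q (k + 1) =
      ∑ k : Fin t, extend q (k + 1) * extend p k := Finset.sum_congr rfl fun k _ => mul_comm _ _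
  rw [h6]
  ring

/-- The comparability matrix of a wattle is positive definite. -/
theorem posDef [Fintype S] : (comparabilityMatrix S ℝ).PosDef := by
  refine PosDef.of_dotProduct_mulVec_pos (comparabilityMatrix_isSymm S ℝ) fun x hx => ?_
  rw [star_trivial, hZ.dotProduct_mulVec_eq]
  set q : Fin t → ℝ := fun j => x (hZ.top j) with hq
  have hterm : ∀ k : Fin t, 0 ≤ (∑ s ∈ Z k, x s) ^ 2 +
      (x (hZ.bot k) + extend q (k + 1)) ^ 2 +
      ∑ s ∈ ((Z k).erase (hZ.bot k)).erase (hZ.top k), x s ^ 2 := fun k => by positivity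
  by_contra! hle
  have hsum := Finset.sum_nonneg fun k (_ : k ∈ Finset.univ) => hterm k
  have hq0 : extend q 0 = 0 := by
    have : extend q 0 ^ 2 = 0 := by
      have := sq_nonneg (extend q 0)
      linarith
    simpa using this
  have hzero := (Finset.sum_eq_zero_iff_of_nonneg fun k (_ : k ∈ Finset.univ) => hterm k).1
    (by have := sq_nonneg (extend q 0); linarith)
  -- Vanishing propagates: a zero top together with zero middle entries and zero chain sum gives a
  -- zero bottom, hence a zero top in the next chain.
  have hstep : ∀ k : Fin t, x (hZ.top k) = 0 → (∀ s ∈ Z k, x s = 0) ∧ extend q (k + 1) = 0 := by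
    intro k hk
    have h0 := hzero k (Finset.mem_univ k)
    have h1 := sq_nonneg (∑ s ∈ Z k, x s)
    have h2 := sq_nonneg (x (hZ.bot k) + extend q (k + 1))
    have h3 : 0 ≤ ∑ s ∈ ((Z k).erase (hZ.bot k)).erase (hZ.top k), x s ^ 2 :=
      Finset.sum_nonneg fun s _ => sq_nonneg _
    have e1 : ∑ s ∈ Z k, x s = 0 := by
      have : (∑ s ∈ Z k, x s) ^ 2 = 0 := by linarith
      simpa using this
    have e2 : x (hZ.bot k) + extend q (k + 1) = 0 := by
      have : (x (hZ.bot k) + extend q (k + 1)) ^ 2 = 0 := by linarith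
      simpa using this
    have e3 : ∀ s ∈ ((Z k).erase (hZ.bot k)).erase (hZ.top k), x s = 0 := fun s hs => by
      have := (Finset.sum_eq_zero_iff_of_nonneg fun s _ => sq_nonneg (x s)).1
        (by linarith : ∑ s ∈ ((Z k).erase (hZ.bot k)).erase (hZ.top k), x s ^ 2 = 0) s hs
      simpa using this
    rw [hZ.sum_chain, hk, Finset.sum_eq_zero e3, add_zero, add_zero] at e1
    refine ⟨fun s hs => ?_, by linarith⟩
    by_cases hsb : s = hZ.bot k
    · rw [hsb, e1]
    by_cases hst : s = hZ.top k
    · rw [hst, hk]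
    · exact e3 s (by simp [hs, hsb, hst])
  have hall : ∀ n, extend q n = 0 := by
    intro n
    induction n with
    | zero => exact hq0
    | succ n ih =>
      by_cases hn : n < t
      · rw [extend_of_lt q hn] at ih
        exact (hstep ⟨n, hn⟩ ih).2
      · exact extend_of_le q (by omega)
  refine hx (funext fun s => ?_)
  obtain ⟨k, hk⟩ := hZ.cover s
  have := hall k
  rw [extend_val] at this
  exact (hstep k this).1 s hk

end IsWattle

/-- A solution of the equations that describe the weights of the wattle `⟨n 0, …, n (t - 1)⟩`. -/
structure IsSolution (t : ℕ) (n : ℕ → ℤ) (r : ℝ) (X : ℕ → ℝ) : Prop where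
  zero : X 0 = 0
  last : X t = 1
  mem : ∀ i, 0 < i → i < t → 0 < X i ∧ X i < 1
  step : ∀ k, k < t → (n k : ℝ) - 1 = r - X (k + 1) + X k

namespace IsWattle

variable (hZ : IsWattle Z)
include hZ

theorem exists_weight [Fintype S] {n : ℕ → ℤ} (hn : ∀ k, ((Z k).card : ℤ) = n k) {r : ℝ}
    {X : ℕ → ℝ} (hX : IsSolution t n r X) :
    ∃ u : S → ℝ, (∀ s, 0 < u s) ∧ comparabilityMatrix S ℝ *ᵥ u = 1 := by
  have ht := hZ.one_lt
  have hr : 0 < r := by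
    have h1 := hX.step 0 (by omega)
    have h2 := (hX.mem 1 one_pos ht).1
    have h3 : (2 : ℝ) ≤ n 0 := by
      have h4 := hZ.two_le_card ⟨0, by omega⟩
      have h5 := hn ⟨0, by omega⟩
      simp only at h5
      have : (2 : ℤ) ≤ n 0 := by omega
      exact_mod_cast this
    rw [hX.zero] at h1
    linarith
  have hα : 0 < 1 + r := by linarith
  choose idx hidx using hZ.cover
  have hidx' : ∀ {k s}, s ∈ Z k → idx s = k := fun hs => hZ.eq_of_mem (hidx _) hs
  -- The weights scaled so that middle elements have weight 1. Linked elements get X and 1 - X, so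
  -- every chain has total r and every row gives 1 + r; X 0 = 0 and X t = 1 give weight 1 to the
  -- unlinked first top and last bottom.
  set v : S → ℝ := fun s => if s = hZ.bot (idx s) then X (idx s + 1) else
    if s = hZ.top (idx s) then 1 - X (idx s) else 1 with hv
  have hbot : ∀ k, v (hZ.bot k) = X (k + 1) := fun k => by
    simp [hv, hidx' (hZ.bot_mem k)]
  have htop : ∀ k, v (hZ.top k) = 1 - X k := fun k => by
    simp [hv, hidx' (hZ.top_mem k), (hZ.bot_ne_top k).symm]
  have hmid : ∀ {k s}, s ∈ Z k → s ≠ hZ.bot k → s ≠ hZ.top k → v s = 1 := fun {k s} hs h1 h2 => by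
    simp [hv, hidx' hs, h1, h2]
  have hsum : ∀ k, ∑ s ∈ Z k, v s = r := by
    intro k
    rw [hZ.sum_chain, hbot, htop, Finset.sum_congr rfl fun s hs => hmid
      (Finset.mem_of_mem_erase (Finset.mem_of_mem_erase hs))
      (Finset.ne_of_mem_erase (Finset.mem_of_mem_erase hs)) (Finset.ne_of_mem_erase hs)]
    have h1 : (((Z k).erase (hZ.bot k)).erase (hZ.top k)).card + 2 = (Z k).card := by
      rw [Finset.card_erase_of_mem (Finset.mem_erase.2 ⟨(hZ.bot_ne_top k).symm, hZ.top_mem k⟩),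
        Finset.card_erase_of_mem (hZ.bot_mem k)]
      have := hZ.two_le_card k
      omega
    have h2 := hn k
    rw [← h1] at h2
    have h3 : ((((Z k).erase (hZ.bot k)).erase (hZ.top k)).card : ℝ) + 2 = n k := by
      exact_mod_cast h2
    have h4 := hX.step k k.2
    simp only [Finset.sum_const, nsmul_eq_mul, mul_one]
    linarith
  have hpos : ∀ s, 0 < v s := by
    intro s
    by_cases h1 : s = hZ.bot (idx s)
    · rw [h1, hbot]
      by_cases h2 : (idx s : ℕ) + 1 = t
      · rw [h2, hX.last]
        exact one_pos
      · exact (hX.mem _ (by omega) (by omega)).1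
    by_cases h2 : s = hZ.top (idx s)
    · rw [h2, htop]
      by_cases h3 : (idx s : ℕ) = 0
      · rw [h3, hX.zero]
        norm_num
      · linarith [(hX.mem _ (Nat.pos_of_ne_zero h3) (idx s).2).2]
    · rw [hmid (hidx s) h1 h2]
      exact one_pos
  have hmul : ∀ s, (comparabilityMatrix S ℝ *ᵥ v) s = 1 + r := by
    intro s
    obtain ⟨k, hs⟩ := hZ.cover s
    rw [hZ.comparabilityMatrix_mulVec_apply v hs, hsum]
    by_cases h1 : s = hZ.bot k
    · subst h1
      rw [if_pos rfl, if_neg (hZ.bot_ne_top k), hbot]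
      by_cases h2 : (k : ℕ) + 1 < t
      · rw [extend_of_lt _ h2, htop]
        ring
      · rw [extend_of_le _ (by omega), show (k : ℕ) + 1 = t by omega, hX.last]
        ring
    by_cases h2 : s = hZ.top k
    · subst h2
      rw [if_pos rfl, if_neg h1, htop]
      rcases k with ⟨_ | k, hk⟩
      · simp only [extendShift, hX.zero]
        ring
      · simp only [extendShift]
        rw [extend_of_lt _ (by omega), hbot]
        ring
    · rw [if_neg h1, if_neg h2, hmid hs h1 h2]
      ring
  refine ⟨(1 + r)⁻¹ • v, fun s => mul_pos (inv_pos.2 hα) (hpos s), ?_⟩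
  funext s
  rw [mulVec_smul, Pi.smul_apply, hmul, smul_eq_mul, inv_mul_cancel₀ hα.ne', Pi.one_apply]

theorem exists_isSolution [Fintype S] {n : ℕ → ℤ} (hn : ∀ k, ((Z k).card : ℤ) = n k)
    {u : S → ℝ} (hu : ∀ s, 0 < u s) (hAu : comparabilityMatrix S ℝ *ᵥ u = 1) :
    ∃ (r : ℝ) (X : ℕ → ℝ), IsSolution t n r X := by
  have ht := hZ.one_lt
  have heq : ∀ {k : Fin t} {s : S}, s ∈ Z k → u s + (∑ a ∈ Z k, u a +
      (if s = hZ.bot k then extend (fun j => u (hZ.top j)) (k + 1) else 0) +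
      if s = hZ.top k then extendShift (fun j => u (hZ.bot j)) k else 0) = 1 := fun hs => by
    rw [← hZ.comparabilityMatrix_mulVec_apply u hs, hAu, Pi.one_apply]
  have hbot : ∀ k, u (hZ.bot k) + ∑ a ∈ Z k, u a +
      extend (fun j => u (hZ.top j)) (k + 1) = 1 := fun k => by
    have := heq (hZ.bot_mem k)
    rw [if_pos rfl, if_neg (hZ.bot_ne_top k)] at this
    linarith
  have htop : ∀ k, u (hZ.top k) + ∑ a ∈ Z k, u a +
      extendShift (fun j => u (hZ.bot j)) k = 1 := fun k => by
    have := heq (hZ.top_mem k)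
    rw [if_pos rfl, if_neg (hZ.bot_ne_top k).symm] at this
    linarith
  have hmid : ∀ {k s}, s ∈ Z k → s ≠ hZ.bot k → s ≠ hZ.top k → u s = 1 - ∑ a ∈ Z k, u a :=
    fun hs h1 h2 => by
      have := heq hs
      rw [if_neg h1, if_neg h2] at this
      linarith
  -- The equations of two linked elements both contain the sum of their weights, so the totals of
  -- adjacent chains agree.
  obtain ⟨z, hz⟩ : ∃ z, ∀ k, ∑ a ∈ Z k, u a = z := by
    refine ⟨∑ a ∈ Z ⟨0, by omega⟩, u a, fun ⟨k, hk⟩ => ?_⟩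
    induction k with
    | zero => rfl
    | succ k ih =>
      rw [← ih (by omega)]
      have h1 := hbot ⟨k, by omega⟩
      have h2 := htop ⟨k + 1, hk⟩
      rw [extend_of_lt _ hk] at h1
      simp only [extendShift] at h2
      rw [extend_of_lt _ (by omega)] at h2
      linarith
  simp only [hz] at hbot htop hmid
  have hα : 0 < 1 - z := by
    have h1 := htop ⟨0, by omega⟩
    simp only [extendShift] at h1
    linarith [hu (hZ.top ⟨0, by omega⟩)]
  set p : Fin t → ℝ := fun j => u (hZ.bot j) with hp
  -- Dividing by the weight 1 - z of a middle element; `X i` comes from the bottom of the chain with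
  -- index i - 1.
  refine ⟨z / (1 - z), fun i => extendShift p i / (1 - z), ?_, ?_, ?_, ?_⟩
  · simp [extendShift]
  · obtain ⟨m, rfl⟩ : ∃ m, t = m + 1 := ⟨t - 1, by omega⟩
    have h1 := hbot ⟨m, by omega⟩
    rw [extend_of_le _ (by simp)] at h1
    simp only [extendShift]
    rw [extend_of_lt _ (by omega), div_eq_one_iff_eq hα.ne']
    linarith
  · intro i hi hit
    obtain ⟨m, rfl⟩ : ∃ m, i = m + 1 := ⟨i - 1, by omega⟩
    simp only [extendShift]
    rw [extend_of_lt _ (by omega)]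
    refine ⟨div_pos (hu _) hα, (div_lt_one hα).2 ?_⟩
    have h1 := hbot ⟨m, by omega⟩
    rw [extend_of_lt _ hit] at h1
    have := hu (hZ.top ⟨m + 1, hit⟩)
    simp only [hp]
    linarith
  · intro k hk
    have h1 := hz ⟨k, hk⟩
    rw [hZ.sum_chain, Finset.sum_congr rfl fun s hs => hmid
      (Finset.mem_of_mem_erase (Finset.mem_of_mem_erase hs))
      (Finset.ne_of_mem_erase (Finset.mem_of_mem_erase hs)) (Finset.ne_of_mem_erase hs)] at h1
    have h2 : (((Z ⟨k, hk⟩).erase (hZ.bot ⟨k, hk⟩)).erase (hZ.top ⟨k, hk⟩)).card + 2 =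
        (Z ⟨k, hk⟩).card := by
      rw [Finset.card_erase_of_mem (Finset.mem_erase.2 ⟨(hZ.bot_ne_top _).symm, hZ.top_mem _⟩),
        Finset.card_erase_of_mem (hZ.bot_mem _)]
      have := hZ.two_le_card ⟨k, hk⟩
      omega
    have h3 := hn ⟨k, hk⟩
    rw [← h2] at h3
    have h4 : ((((Z ⟨k, hk⟩).erase (hZ.bot ⟨k, hk⟩)).erase (hZ.top ⟨k, hk⟩)).card : ℝ) =
        n k - 2 := by
      have : ((((Z ⟨k, hk⟩).erase (hZ.bot ⟨k, hk⟩)).erase (hZ.top ⟨k, hk⟩)).card : ℝ) + 2 =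
        n k := by exact_mod_cast h3
      linarith
    simp only [Finset.sum_const, nsmul_eq_mul, h4] at h1
    have h5 := htop ⟨k, hk⟩
    simp only at h5
    have h6 : extendShift p (k + 1) = u (hZ.bot ⟨k, hk⟩) := by
      simp only [extendShift]
      rw [extend_of_lt _ hk]
    rw [h6]
    field_simp
    linarith

end IsWattle

end Wattles

/-! ### Solutions of the weight equations and the uniform wattles -/

section UniformWattles

/-- Telescoping gives N i = r i - X i, so N i = ⌊r i⌋ for i < t. As X t = 1, r t = N t + 1 and r is
rational; as X i is not 0 for 0 < i < t, no smaller multiple of r is an integer, so the denominator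
is exactly t. -/
theorem IsSolution.exists_rat {t : ℕ} {n : ℕ → ℤ} {r : ℝ} {X : ℕ → ℝ} (h : IsSolution t n r X)
    (ht : 1 < t) (hn : ∀ k, k < t → 2 ≤ n k) : ∃ q : ℚ, 1 < q ∧ (∀ m : ℤ, q ≠ m) ∧ q.den = t ∧
      ∀ k, k < t → n k = zetaOrder q t (k + 1) := by
  set N : ℕ → ℤ := fun i => ∑ j ∈ Finset.range i, (n j - 1) with hN
  have hN0 : N 0 = 0 := by simp [hN]
  have hNs : ∀ i, N (i + 1) = N i + (n i - 1) := fun i => Finset.sum_range_succ _ _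
  have hNX : ∀ i, i ≤ t → (N i : ℝ) = r * i - X i := by
    intro i
    induction i with
    | zero => simp [hN0, h.zero]
    | succ i ih =>
      intro hi
      have h1 := h.step i (by omega)
      rw [hNs]
      push_cast
      rw [ih (by omega)]
      linarith
  have ht0 : (t : ℝ) ≠ 0 := by
    have : t ≠ 0 := by omega
    exact_mod_cast this
  set q : ℚ := Rat.divInt (N t + 1) t with hq
  have hqr : (q : ℝ) = r := by
    rw [hq, Rat.divInt_eq_div]
    push_cast
    rw [hNX t le_rfl, h.last]
    field_simp
    ring
  have hX : ∀ i, i < t → 0 ≤ X i ∧ X i < 1 := by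
    intro i hi
    rcases Nat.eq_zero_or_pos i with rfl | hi0
    · rw [h.zero]
      norm_num
    · exact ⟨(h.mem i hi0 hi).1.le, (h.mem i hi0 hi).2⟩
  have hfl : ∀ i, i < t → ⌊q * i⌋ = N i := by
    intro i hi
    rw [Int.floor_eq_iff]
    have h1 := hNX i hi.le
    have h2 := hX i hi
    have h3 : (N i : ℝ) ≤ q * i := by rw [hqr]; linarith
    have h4 : (q : ℝ) * i < N i + 1 := by rw [hqr]; linarith
    exact ⟨by exact_mod_cast h3, by exact_mod_cast h4⟩
  have hnotint : ∀ i, 0 < i → i < t → ∀ m : ℤ, q * i ≠ m := by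
    intro i hi hit m hm
    have h1 := hfl i hit
    rw [hm, Int.floor_intCast] at h1
    have h2 := hNX i hit.le
    have h3 : (q : ℝ) * i = m := by exact_mod_cast hm
    have h4 := (h.mem i hi hit).1
    rw [← h1, ← h3, hqr] at h2
    linarith
  have hden : q.den = t := by
    have h1 : q.den ∣ t := by
      have := Rat.den_dvd (N t + 1) t
      rw [← hq] at this
      exact_mod_cast this
    have h2 : q.den ≤ t := Nat.le_of_dvd (by omega) h1
    by_contra hne
    exact hnotint q.den q.den_pos (by omega) q.num (Rat.mul_den_eq_num q)
  have hfl1 : ⌊q⌋ = n 0 - 1 := by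
    have h1 := hfl 1 ht
    rw [Nat.cast_one, mul_one] at h1
    rw [h1, hNs, hN0, zero_add]
  refine ⟨q, ?_, fun m => ?_, hden, fun k hk => ?_⟩
  · have h1 := h.step 0 (by omega)
    have h2 := (h.mem 1 one_pos ht).1
    have h3 : (2 : ℝ) ≤ n 0 := by exact_mod_cast hn 0 (by omega)
    rw [h.zero] at h1
    have h4 : (1 : ℝ) < q := by
      rw [hqr]
      linarith
    exact_mod_cast h4
  · simpa using hnotint 1 one_pos ht m
  · unfold zetaOrder
    split_ifs with hc
    · rcases hc with hc | hc
      · have : k = 0 := by omega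
        rw [this, hfl1]
        ring
      -- In the last chain X t = 1 in place of a fractional part 0, so n k - 1 = r - 1 + X k lies
      -- strictly between r - 1 and r.
      · have h1 := h.step k hk
        rw [hc, h.last] at h1
        have h2 := h.mem k (by omega) hk
        have h3 : ⌊q⌋ = n k - 1 := by
          rw [Int.floor_eq_iff]
          have h4 : ((n k - 1 : ℤ) : ℝ) ≤ q := by
            rw [hqr]
            push_cast
            linarith
          have h5 : (q : ℝ) < ((n k - 1 : ℤ) : ℝ) + 1 := by
            rw [hqr]
            push_cast
            linarith
          exact ⟨by exact_mod_cast h4, by exact_mod_cast h5⟩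
        rw [h3]
        ring
    · have h1 : ((k + 1 : ℕ) : ℚ) - 1 = (k : ℕ) := by
        push_cast
        ring
      rw [h1, hfl (k + 1) (by omega), hfl k hk, hNs]
      ring

/-- The solution is X i = fract (q i), except at the denominator, where the value is 1 rather than
0. -/
theorem isSolution_of_zetaOrder {q : ℚ} (hq : ∀ m : ℤ, q ≠ m) {n : ℕ → ℤ}
    (hn : ∀ k, k < q.den → n k = zetaOrder q q.den (k + 1)) :
    IsSolution q.den n q fun i => ((if i = q.den then 1 else Int.fract (q * i) : ℚ) : ℝ) := by
  have hpos := q.den_pos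
  have hden : 1 < q.den := by
    by_contra hd
    have h1 : q.den = 1 := by omega
    exact hq q.num ((Rat.den_eq_one_iff q).1 h1).symm
  have hnotint : ∀ i : ℕ, 0 < i → i < q.den → 0 < Int.fract (q * i) := by
    intro i hi hid
    refine lt_of_le_of_ne (Int.fract_nonneg _) fun h => ?_
    have h1 : q * i = ⌊q * i⌋ := by
      have := Int.floor_add_fract (q * i)
      rw [← h, add_zero] at this
      exact this.symm
    have hi' : (i : ℚ) ≠ 0 := by
      have : i ≠ 0 := by omega
      exact_mod_cast this
    have h2 : q = Rat.divInt ⌊q * i⌋ i := by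
      rw [Rat.divInt_eq_div, Int.cast_natCast, ← h1, mul_div_cancel_right₀ _ hi']
    have h3 := Rat.den_dvd ⌊q * i⌋ i
    rw [← h2] at h3
    have h4 : q.den ∣ i := by exact_mod_cast h3
    exact absurd (Nat.le_of_dvd hi h4) (not_le.2 hid)
  refine ⟨?_, ?_, ?_, ?_⟩
  · simp [hpos.ne]
  · simp
  · intro i hi hid
    rw [if_neg hid.ne]
    have h1 := hnotint i hi hid
    have h2 := Int.fract_lt_one (q * i)
    exact ⟨by exact_mod_cast h1, by exact_mod_cast h2⟩
  · intro k hk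
    have key : (n k : ℚ) - 1 = q - (if k + 1 = q.den then 1 else Int.fract (q * (k + 1 : ℕ))) +
        (if k = q.den then 1 else Int.fract (q * k)) := by
      rw [if_neg hk.ne, hn k hk]
      unfold zetaOrder
      by_cases h1 : k + 1 = q.den
      · rw [if_pos (Or.inr h1), if_pos h1]
        -- Here k is the denominator minus 1, so q k is an integer minus q, with fractional part 1 -
        -- fract q.
        have h2 : q * k = (q.num - 1 - ⌊q⌋ : ℤ) + (1 - Int.fract q) := by
          have h3 := Rat.mul_den_eq_num q
          rw [← h1] at h3
          push_cast at h3 ⊢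
          have := Int.floor_add_fract q
          linarith
        have h4 : Int.fract (q * k) = 1 - Int.fract q := by
          rw [h2, Int.fract_intCast_add, Int.fract_eq_self]
          have h5 := hnotint 1 one_pos hden
          rw [Nat.cast_one, mul_one] at h5
          exact ⟨by linarith [Int.fract_lt_one q], by linarith⟩
        rw [h4]
        have := Int.floor_add_fract q
        push_cast
        linarith
      · by_cases h2 : k = 0
        · subst h2
          rw [if_pos (Or.inl rfl), if_neg h1]
          simp only [Nat.cast_zero, mul_zero, Int.fract_zero, zero_add, Nat.cast_one, mul_one,
            add_zero]
          have := Int.floor_add_fract q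
          push_cast
          linarith
        · rw [if_neg (by omega), if_neg h1]
          have h3 : ((k + 1 : ℕ) : ℚ) - 1 = (k : ℕ) := by
            push_cast
            ring
          rw [h3]
          unfold Int.fract
          push_cast
          ring
    have key' := congrArg (fun x : ℚ => (x : ℝ)) key
    push_cast at key' ⊢
    exact key'

variable {S : Type*} [PartialOrder S]

/-- The uniform wattles are the wattles whose comparability matrix has positive weights. -/
theorem IsWattle.exists_isUniformWattle [Fintype S] {t : ℕ} {Z : Fin t → Finset S}
    (hZ : IsWattle Z) (hW : HasPositiveWeight (comparabilityMatrix S ℝ)) :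
    ∃ r : ℚ, IsUniformWattle S r := by
  obtain ⟨u, hu, hAu⟩ := hW.2
  set n : ℕ → ℤ := fun k => if h : k < t then ((Z ⟨k, h⟩).card : ℤ) else 0 with hn
  have hnk : ∀ k : Fin t, ((Z k).card : ℤ) = n k := fun k => by simp [hn]
  obtain ⟨r, X, hX⟩ := hZ.exists_isSolution hnk hu hAu
  obtain ⟨q, hq1, hq2, hq3, hq4⟩ := hX.exists_rat hZ.one_lt fun k hk => by
    have h1 := hZ.two_le_card ⟨k, hk⟩
    have h2 := hnk ⟨k, hk⟩
    simp only at h2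
    omega
  rw [← Rat.den_intFract] at hq3
  subst hq3
  exact ⟨q, hq1, hq2, Z, hZ, fun k => (hnk k).trans (hq4 k k.2)⟩

theorem IsUniformWattle.hasPositiveWeight [Fintype S] {r : ℚ} (h : IsUniformWattle S r) :
    HasPositiveWeight (comparabilityMatrix S ℝ) := by
  obtain ⟨-, hr, Z, hZ, hcard⟩ := h
  have hX := isSolution_of_zetaOrder (n := fun k => zetaOrder r r.den (k + 1)) hr fun k _ => rfl
  rw [← Rat.den_intFract] at hX
  exact ⟨hZ.posDef, hZ.exists_weight hcard hX⟩

/-- For a chain, A is the identity plus the all-ones matrix, so the weight is constant. -/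
theorem hasPositiveWeight_of_isChain [Fintype S] (h : IsChain (· ≤ ·) (Set.univ : Set S)) :
    HasPositiveWeight (comparabilityMatrix S ℝ) := by
  classical
  have hmul : ∀ (x : S → ℝ) s, (comparabilityMatrix S ℝ).mulVec x s = x s + ∑ t, x t := by
    intro x s
    rw [comparabilityMatrix_mulVec, Finset.filter_true_of_mem]
    exact fun t _ => h.total (Set.mem_univ t) (Set.mem_univ s)
  refine ⟨Matrix.PosDef.of_dotProduct_mulVec_pos (comparabilityMatrix_isSymm S ℝ) fun x hx => ?_,
    fun _ => (1 + (Fintype.card S : ℝ))⁻¹, fun _ => by positivity, ?_⟩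
  · have h1 : dotProduct x ((comparabilityMatrix S ℝ).mulVec x) =
        ∑ s, x s ^ 2 + (∑ s, x s) ^ 2 := by
      simp only [dotProduct, hmul, mul_add, Finset.sum_add_distrib, ← Finset.sum_mul, sq]
    rw [star_trivial, h1]
    obtain ⟨s, hs⟩ := Function.ne_iff.1 hx
    have h2 : 0 < ∑ s, x s ^ 2 := Finset.sum_pos' (fun s _ => sq_nonneg _)
      ⟨s, Finset.mem_univ s, by simpa using sq_pos_of_ne_zero hs⟩
    positivity
  · funext s
    rw [hmul]
    simp only [Finset.sum_const, Finset.card_univ, nsmul_eq_mul, Pi.one_apply]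
    field_simp

theorem hasPositiveWeight_iff_isRSet [Fintype S] (hconn : (SimpleGraph.hasse S).Connected) :
    HasPositiveWeight (comparabilityMatrix S ℝ) ↔ IsRSet S := by
  constructor
  · intro hW
    by_cases hchain : IsChain (· ≤ ·) (Set.univ : Set S)
    · exact Or.inl hchain
    · obtain ⟨t, Z, hZ⟩ := hW.exists_isWattle hconn hchain
      exact Or.inr (hZ.exists_isUniformWattle hW)
  · rintro (h | ⟨r, h⟩)
    · exact hasPositiveWeight_of_isChain h
    · exact h.hasPositiveWeight

end UniformWattles

end AntimonotonousPosets

theorem mainTheorem1 {S : Type*} [Fintype S] [PartialOrder S]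
    (hconn : (SimpleGraph.hasse S).Connected) :
    ((∀ x : S → ℝ, 0 ≤ AntimonotonousPosets.posetForm S x) →
      (AntimonotonousPosets.IsAntimonotonous (AntimonotonousPosets.posetForm S) ↔
        AntimonotonousPosets.IsRSet S)) ∧
    (AntimonotonousPosets.IsPFaithful S ↔ AntimonotonousPosets.IsRSet S) := by
  have hne : Nonempty S := hconn.nonempty
  rw [← AntimonotonousPosets.hasPositiveWeight_iff_isRSet hconn]
  exact ⟨AntimonotonousPosets.isAntimonotonous_iff_hasPositiveWeight S,
    AntimonotonousPosets.isPFaithful_iff_hasPositiveWeight S⟩
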